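/- Let $a:[0,1]\to\mathbb R$ be continuous with $a(0)=0$ and $a>0$ on $(0,1]$, and assume that there is $K\in(0,2)$ such that $x\mapsto x^K/a(x)$ is non-decreasing on a right neighbourhood of $0$. Let $$L^2_{1/a}=\Big\{u\in L^2(0,1):\ \|u\|_{L^2_{1/a}}^2:=\int_0^1\frac{u^2}{a}\,dx<\infty\Big\},\qquad H^2_{1/a}=L^2_{1/a}\cap H^2_0(0,1),$$ where $H^2_{1/a}$ has the norm $\|u\|_{H^2_{1/a}}^2=\|u\|_{L^2_{1/a}}^2+\|u'\|_{L^2(0,1)}^2+\|u''\|_{L^2(0,1)}^2$ and $H^2_0(0,1)=\{u\in H^2(0,1): u=u'=0 \text{ at } x=0,1\}$. Let $Au=a\,u''''$ (weak derivative on $(0,1)$) with domain $D(A)=\{u\in H^2_{1/a}: a\,u''''\in L^2_{1/a}\}$, equipped with the graph norm. On $\mathcal H_0=H^2_{1/a}\times L^2_{1/a}$ let $\mathcal A(u,v)=(v,-Au)$ with domain $D(\mathcal A)=D(A)\times H^2_{1/a}$. Consider the problem $$y_{tt}+a\,y_{xxxx}=0\ \text{ in }(0,\infty)\times(0,1),\quad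 y=y_x=0\ \text{ at }x=0,1,\quad y(0)=y^0,\ y_t(0)=y^1. \tag{P}$$ A function $y\in C^1([0,\infty);L^2_{1/a})\cap C([0,\infty);H^2_{1/a})$ with $y(0)=y^0$, $y_t(0)=y^1$ is called a mild solution of (P) if $\mathcal U=(y,y_t)$ is a mild solution of $\dot{\mathcal U}=\mathcal A\,\mathcal U$, i.e. for every $t\ge 0$ one has $\int_0^t\mathcal U(s)\,ds\in D(\mathcal A)$ and $\mathcal U(t)=\mathcal U(0)+\mathcal A\int_0^t\mathcal U(s)\,ds$. (i) For every $(y^0,y^1)\in\mathcal H_0$, problem (P) has a unique mild solution $y\in C^1([0,\infty);L^2_{1/a})\cap C([0,\infty);H^2_{1/a})$. (ii) The solution depends continuously on the data: there is a constant $C$, depending only on $a$, such that if $y,z$ are the mild solutions with data $(y^0,y^1),(z^0,z^1)\in\mathcal H_0$, then for all $t\ge0$ $$\|y(t)-z(t)\|_{H^2_{1/a}}+\|y_t(t)-z_t(t)\|_{L^2_{1/a}}\le C\big(\|y^0-z^0\|_{H^2_{1/a}}+\|y^1-z^1\|_{L^2_{1/a}}\big).$$ (iii) If $(y^0,y^1)\in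 D(\mathcal A)$, then the mild solution is classical: $$y\in C^2([0,\infty);L^2_{1/a})\cap C^1([0,\infty);H^2_{1/a})\cap C([0,\infty);D(A)),$$ and $y_{tt}(t)+Ay(t)=0$ in $L^2_{1/a}$ for every $t\ge0$. -/

import Mathlib

open MeasureTheory Set
open scoped ContDiff ENNReal

/-- Hypothesis on the coefficient: `a` is continuous on `[0,1]`, `a 0 = 0`, `a > 0` on `(0,1]`, and
for some `K ∈ (0,2)` the function `x ↦ x ^ K / a x` is non decreasing near `0` (to the right). -/
structure DegenerateCoefficient (a : ℝ → ℝ) : Prop where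
  continuousOn : ContinuousOn a (Icc 0 1)
  zero : a 0 = 0
  pos : ∀ x ∈ Ioc (0 : ℝ) 1, 0 < a x
  monotone_near_zero : ∃ K ∈ Ioo (0 : ℝ) 2, ∃ δ ∈ Ioc (0 : ℝ) 1,
    MonotoneOn (fun x : ℝ => x ^ K / a x) (Ioo 0 δ)

/-- Lebesgue measure on `(0,1)`. -/
noncomputable abbrev unitMeasure : Measure ℝ := volume.restrict (Ioo 0 1)

/-- The measure `(1 / a(x)) dx` on `(0,1)`. -/
noncomputable def weightMeasure (a : ℝ → ℝ) : Measure ℝ :=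
  unitMeasure.withDensity (fun x => ENNReal.ofReal (1 / a x))

/-- `L²(0,1)`. -/
noncomputable abbrev L2 : Type := Lp ℝ 2 unitMeasure

/-- `L²_{1/a}(0,1)`, with `‖u‖² = ∫₀¹ u² / a dx`. (As `a` is bounded on `(0,1)`, finiteness of this
integral already forces `u ∈ L²(0,1)`.) -/
noncomputable abbrev L2w (a : ℝ → ℝ) : Type := Lp ℝ 2 (weightMeasure a)

/-- Smooth functions with compact support in the open interval `(0,1)`. -/
def IsTestFunction (φ : ℝ → ℝ) : Prop :=
  ContDiff ℝ ∞ φ ∧ HasCompactSupport φ ∧ tsupport φ ⊆ Ioo 0 1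

/-- `g` is the weak derivative of order `k` of `f` on the open interval `(0,1)`. -/
def HasWeakDeriv (k : ℕ) (f g : ℝ → ℝ) : Prop :=
  LocallyIntegrableOn f (Ioo 0 1) ∧ LocallyIntegrableOn g (Ioo 0 1) ∧
    ∀ φ : ℝ → ℝ, IsTestFunction φ →
      ∫ x in Ioo (0 : ℝ) 1, f x * iteratedDeriv k φ x =
        (-1) ^ k * ∫ x in Ioo (0 : ℝ) 1, g x * φ x

/-- `f ∈ H²₀(0,1)` with `f' = f₁` and `f'' = f₂`. Here `f` and `f₁` are the representatives that are
continuous on `[0,1]`, and both vanish at the two end points. (Being continuous on `[0,1]`, they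
belong to `L²(0,1)`.) -/
structure IsH20 (f f₁ f₂ : ℝ → ℝ) : Prop where
  continuousOn : ContinuousOn f (Icc 0 1)
  continuousOn_deriv : ContinuousOn f₁ (Icc 0 1)
  memLp : MemLp f₂ 2 unitMeasure
  weakDeriv_one : HasWeakDeriv 1 f f₁
  weakDeriv_two : HasWeakDeriv 2 f f₂
  left : f 0 = 0
  right : f 1 = 0
  deriv_left : f₁ 0 = 0
  deriv_right : f₁ 1 = 0

theorem HasWeakDeriv.integrable_mul {f ψ : ℝ → ℝ} (hf : LocallyIntegrableOn f (Ioo 0 1))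
    (hψ : Continuous ψ) (hc : HasCompactSupport ψ) (hs : tsupport ψ ⊆ Ioo 0 1) :
    Integrable (fun x => f x * ψ x) unitMeasure := by
  have h1 : IntegrableOn (fun x => f x * ψ x) (tsupport ψ) :=
    (hf.integrableOn_compact_subset hs hc).mul_continuousOn hψ.continuousOn hc
  have h2 : Integrable (fun x => f x * ψ x) := by
    rw [← integrableOn_iff_integrable_of_support_subset (s := tsupport ψ)]
    · exact h1
    · intro x hx
      apply subset_tsupport
      intro h
      apply hx
      simp [h]
  exact h2.integrableOn

theorem IsTestFunction.integrable_mul_iteratedDeriv {f φ : ℝ → ℝ} (hφ : IsTestFunction φ) (k : ℕ)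
    (hf : LocallyIntegrableOn f (Ioo 0 1)) :
    Integrable (fun x => f x * iteratedDeriv k φ x) unitMeasure := by
  have hsub : tsupport (iteratedDeriv k φ) ⊆ tsupport φ := by
    refine closure_minimal ?_ (isClosed_tsupport φ)
    intro x hx
    rw [Function.mem_support, iteratedDeriv_eq_iteratedFDeriv] at hx
    apply support_iteratedFDeriv_subset (𝕜 := ℝ) k
    intro h
    apply hx
    simp [h]
  exact HasWeakDeriv.integrable_mul hf
    (hφ.1.continuous_iteratedDeriv k (by exact_mod_cast le_top))
    (hφ.2.1.of_isClosed_subset (isClosed_tsupport _) hsub) (hsub.trans hφ.2.2)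

theorem HasWeakDeriv.zero (k : ℕ) : HasWeakDeriv k (fun _ => 0) (fun _ => 0) := by
  refine ⟨locallyIntegrableOn_zero, locallyIntegrableOn_zero, fun φ _ => by simp⟩

theorem HasWeakDeriv.add {k : ℕ} {f g f' g' : ℝ → ℝ} (h : HasWeakDeriv k f g)
    (h' : HasWeakDeriv k f' g') :
    HasWeakDeriv k (fun x => f x + f' x) (fun x => g x + g' x) := by
  refine ⟨h.1.add h'.1, h.2.1.add h'.2.1, fun φ hφ => ?_⟩
  have e1 := integral_add (hφ.integrable_mul_iteratedDeriv k h.1)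
    (hφ.integrable_mul_iteratedDeriv k h'.1)
  have e2 := integral_add (HasWeakDeriv.integrable_mul h.2.1 hφ.1.continuous hφ.2.1 hφ.2.2)
    (HasWeakDeriv.integrable_mul h'.2.1 hφ.1.continuous hφ.2.1 hφ.2.2)
  simp only [add_mul]
  rw [e1, e2, h.2.2 φ hφ, h'.2.2 φ hφ]
  ring

theorem HasWeakDeriv.const_mul {k : ℕ} {f g : ℝ → ℝ} (c : ℝ) (h : HasWeakDeriv k f g) :
    HasWeakDeriv k (fun x => c * f x) (fun x => c * g x) := by
  refine ⟨h.1.smul c, h.2.1.smul c, fun φ hφ => ?_⟩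
  simp only [mul_assoc, integral_const_mul]
  rw [h.2.2 φ hφ]
  ring

theorem IsH20.zero : IsH20 (fun _ => 0) (fun _ => 0) (fun _ => 0) :=
  ⟨continuousOn_const, continuousOn_const, MemLp.zero', .zero 1, .zero 2, rfl, rfl, rfl, rfl⟩

theorem IsH20.add {f f₁ f₂ g g₁ g₂ : ℝ → ℝ} (h : IsH20 f f₁ f₂) (h' : IsH20 g g₁ g₂) :
    IsH20 (fun x => f x + g x) (fun x => f₁ x + g₁ x) (fun x => f₂ x + g₂ x) :=
  ⟨h.1.add h'.1, h.2.add h'.2, h.3.add h'.3, h.4.add h'.4, h.5.add h'.5,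
    by simp [h.6, h'.6], by simp [h.7, h'.7], by simp [h.8, h'.8], by simp [h.9, h'.9]⟩

theorem IsH20.const_mul {f f₁ f₂ : ℝ → ℝ} (c : ℝ) (h : IsH20 f f₁ f₂) :
    IsH20 (fun x => c * f x) (fun x => c * f₁ x) (fun x => c * f₂ x) :=
  ⟨continuousOn_const.mul h.1, continuousOn_const.mul h.2, h.3.const_mul c, h.4.const_mul c,
    h.5.const_mul c, by simp [h.6], by simp [h.7], by simp [h.8], by simp [h.9]⟩

/-- `H²_{1/a}(0,1) = L²_{1/a}(0,1) ∩ H²₀(0,1)`. An element `u` is realised as the triple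
`(u, u', u'')` in the Hilbert sum `L²_{1/a} ⊕ L² ⊕ L²`, so that the induced norm is
`‖u‖² = ‖u‖²_{L²_{1/a}} + ‖u'‖²_{L²} + ‖u''‖²_{L²}`. -/
noncomputable def H2w (a : ℝ → ℝ) : Submodule ℝ (WithLp 2 (L2w a × WithLp 2 (L2 × L2))) where
  carrier := {p | ∃ f f₁ f₂ : ℝ → ℝ, IsH20 f f₁ f₂ ∧
    p.fst =ᵐ[weightMeasure a] f ∧ p.snd.fst =ᵐ[unitMeasure] f₁ ∧ p.snd.snd =ᵐ[unitMeasure] f₂}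
  zero_mem' := ⟨_, _, _, IsH20.zero, Lp.coeFn_zero .., Lp.coeFn_zero .., Lp.coeFn_zero ..⟩
  add_mem' := by
    rintro p q ⟨f, f₁, f₂, h, h0, h1, h2⟩ ⟨g, g₁, g₂, h', h0', h1', h2'⟩
    exact ⟨_, _, _, h.add h', (Lp.coeFn_add _ _).trans (h0.add h0'),
      (Lp.coeFn_add _ _).trans (h1.add h1'), (Lp.coeFn_add _ _).trans (h2.add h2')⟩
  smul_mem' := by
    rintro c p ⟨f, f₁, f₂, h, h0, h1, h2⟩
    exact ⟨_, _, _, h.const_mul c, (Lp.coeFn_smul _ _).trans (h0.const_smul c),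
      (Lp.coeFn_smul _ _).trans (h1.const_smul c), (Lp.coeFn_smul _ _).trans (h2.const_smul c)⟩

/-- The inclusion `H²_{1/a}(0,1) ⊆ L²_{1/a}(0,1)`. -/
noncomputable def H2w.incl {a : ℝ → ℝ} (u : H2w a) : L2w a := u.1.fst

/-- `D(A) = {u ∈ H²_{1/a}(0,1) : a u'''' ∈ L²_{1/a}(0,1)}` with the graph norm of `A u = a u''''`.
An element `u` is realised as the pair `(u, A u)` in `L²_{1/a} ⊕ L²_{1/a}`. The fourth derivative is
the weak one on `(0,1)`. -/
noncomputable def DomA (a : ℝ → ℝ) : Submodule ℝ (WithLp 2 (L2w a × L2w a)) where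
  carrier := {p | (∃ u : H2w a, H2w.incl u = p.fst) ∧ ∃ f g : ℝ → ℝ, HasWeakDeriv 4 f g ∧
    p.fst =ᵐ[weightMeasure a] f ∧ p.snd =ᵐ[weightMeasure a] fun x => a x * g x}
  zero_mem' := by
    refine ⟨⟨0, rfl⟩, _, _, HasWeakDeriv.zero 4, Lp.coeFn_zero .., ?_⟩
    filter_upwards [Lp.coeFn_zero ℝ 2 (weightMeasure a)] with x hx
    simpa using hx
  add_mem' := by
    rintro p q ⟨⟨u, hu⟩, f, g, h, h0, h1⟩ ⟨⟨u', hu'⟩, f', g', h', h0', h1'⟩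
    refine ⟨⟨u + u', ?_⟩, _, _, h.add h', (Lp.coeFn_add _ _).trans (h0.add h0'),
      (Lp.coeFn_add _ _).trans ((h1.add h1').trans (.of_forall fun x => ?_))⟩
    · rw [WithLp.add_fst, ← hu, ← hu']; rfl
    · exact (mul_add _ _ _).symm
  smul_mem' := by
    rintro c p ⟨⟨u, hu⟩, f, g, h, h0, h1⟩
    refine ⟨⟨c • u, ?_⟩, _, _, h.const_mul c, (Lp.coeFn_smul _ _).trans (h0.const_smul c),
      (Lp.coeFn_smul _ _).trans ((h1.const_smul c).trans (.of_forall fun x => ?_))⟩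
    · rw [WithLp.smul_fst, ← hu]; rfl
    · simp only [Pi.smul_apply, smul_eq_mul]; ring

/-- The inclusion `D(A) ⊆ L²_{1/a}(0,1)`. -/
noncomputable def DomA.incl {a : ℝ → ℝ} (u : DomA a) : L2w a := u.1.fst

/-- The operator `A u = a u''''` on `D(A)`. -/
noncomputable def DomA.opA {a : ℝ → ℝ} (u : DomA a) : L2w a := u.1.snd

/-- `U ∈ D(𝒜) = D(A) × H²_{1/a}` and `𝒜 U = F`, where `𝒜 (u, v) = (v, - A u)`. -/
def IsBeamOp (a : ℝ → ℝ) (U F : L2w a × L2w a) : Prop :=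
  ∃ (u : DomA a) (v : H2w a), U = (DomA.incl u, H2w.incl v) ∧ F = (H2w.incl v, - DomA.opA u)

/-- The time derivative `y_t` on `[0,∞)` (one sided at `0`), taken in `L²_{1/a}(0,1)`. -/
noncomputable def timeDeriv {a : ℝ → ℝ} (y : ℝ → H2w a) (t : ℝ) : L2w a :=
  derivWithin (fun s => H2w.incl (y s)) (Ici 0) t

/-- `U = (y, y_t)`. -/
noncomputable def beamState {a : ℝ → ℝ} (y : ℝ → H2w a) (t : ℝ) : L2w a × L2w a :=
  (H2w.incl (y t), timeDeriv y t)

/-- `y ∈ C¹([0,∞); L²_{1/a}) ∩ C([0,∞); H²_{1/a})` is a mild solution, with data `y₀`, `y₁`, of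
`y_tt + a y_xxxx = 0` with clamped ends: `U = (y, y_t)` is a mild solution of `U' = 𝒜 U`, that is,
`∫₀ᵗ U ds ∈ D(𝒜)` and `U(t) = U(0) + 𝒜 ∫₀ᵗ U ds` for all `t ≥ 0`. The values of `y` at negative times
play no role. -/
structure IsMildSolution (a : ℝ → ℝ) (y₀ : H2w a) (y₁ : L2w a) (y : ℝ → H2w a) : Prop where
  contDiffOn : ContDiffOn ℝ 1 (fun t => H2w.incl (y t)) (Ici 0)
  continuousOn : ContinuousOn y (Ici 0)
  init : y 0 = y₀
  init_deriv : timeDeriv y 0 = y₁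
  mild : ∀ t : ℝ, 0 ≤ t →
    IsBeamOp a (∫ s in (0 : ℝ)..t, beamState y s) (beamState y t - beamState y 0)

/-- `y ∈ C²([0,∞); L²_{1/a}) ∩ C¹([0,∞); H²_{1/a}) ∩ C([0,∞); D(A))`, and the equation
`y_tt + A y = 0` holds for all `t ≥ 0`. -/
structure IsClassical (a : ℝ → ℝ) (y : ℝ → H2w a) : Prop where
  contDiffOn_two : ContDiffOn ℝ 2 (fun t => H2w.incl (y t)) (Ici 0)
  contDiffOn_one : ContDiffOn ℝ 1 y (Ici 0)
  equation : ∃ z : ℝ → DomA a, ContinuousOn z (Ici 0) ∧ ∀ t : ℝ, 0 ≤ t →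
    DomA.incl (z t) = H2w.incl (y t) ∧
      iteratedDerivWithin 2 (fun s => H2w.incl (y s)) (Ici 0) t + DomA.opA (z t) = 0

/-!
The idea is to replace the unbounded generator `𝒜 (u, v) = (v, -A u)` by its bounded inverse.

An element of `H²₀(0,1)` is the double primitive of its second derivative, and the second
derivatives are exactly the functions in `L²(0,1)` orthogonal to `1` and `x`, a closed subspace
`Curvature`. The hypothesis on `a` gives `1 / a ≤ C / x²`, while `|u(x)| ≤ x ‖u''‖`, so
`∫ u² / a ≤ C ‖u''‖²`. Hence `u ↦ u''` is an isomorphism from `H²_{1/a}` onto `Curvature`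
(`DegenerateCoefficient.curvatureEquiv`), through which the inclusion `H²_{1/a} ⊆ L²_{1/a}` becomes
a bounded operator `ι` (`DegenerateCoefficient.embedding`), injective and of dense range.

Test functions are dense in `H²₀`, because a function that is orthogonal to all their second
derivatives is affine. By this density the Gauss–Green formula `⟪A u, v⟫ = ∫ u'' v''` holds for all
`u ∈ D(A)` and `v ∈ H²_{1/a}`, so `A` is the operator of the form `∫ u'' v''`, with inverse `ι ι†`
(`DegenerateCoefficient.mem_domA_iff`). In the variables `(u'', v)` the inverse of `𝒜` is then
`R (f, g) = (-ι† g, ι f)`, a bounded, skew and injective operator on a Hilbert space, and mild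
solutions are the continuous `U` with `R (U(t) - U(0)) = ∫₀ᵗ U`.

For any such `R` this equation is solved by approximating `R⁻¹` with the bounded skew operators
`B_ε = -R (ε - R²)⁻¹`: the isometries `exp (t B_ε)` converge strongly, locally uniformly in `t`
(`IsSkew.exists_trajectory`). Uniqueness holds because `w = ∫₀ᵗ U` satisfies `w = R w'` when
`U(0) = 0`, so that `‖w‖²` has derivative `2 ⟪R w', w'⟫ = 0` (`IsSkew.trajectory_eq_zero`).
Therefore all mild solutions conserve the norm of the energy space, which gives the continuous
dependence. Data in the domain of `𝒜` have the form `R z`; the solution is then `R Z`, where `Z` is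
the trajectory starting at `z`, and `Z` is its continuous time derivative
(`IsMildSolution.isClassical`).
-/

/-! ### Evolution equations with a skew-adjoint generator given by its inverse -/

section SkewOperators

open Filter Topology

variable {X : Type*} [NormedAddCommGroup X] [InnerProductSpace ℝ X]

/-- A bounded operator `B` with `⟪B x, y⟫ = -⟪x, B y⟫`. -/
def IsSkew (B : X →L[ℝ] X) : Prop :=
  ∀ x y : X, inner ℝ (B x) y = -inner ℝ x (B y)

theorem IsSkew.inner_self {B : X →L[ℝ] X} (hB : IsSkew B) (x : X) : inner ℝ x (B x) = 0 := by
  have h := hB x x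
  rw [real_inner_comm] at h
  linarith

theorem IsSkew.sub {B C : X →L[ℝ] X} (hB : IsSkew B) (hC : IsSkew C) : IsSkew (B - C) := by
  intro x y
  simp only [sub_apply, inner_sub_left, inner_sub_right, hB x y, hC x y]
  ring

/-- `ε - R²`, which is coercive when `R` is skew and `ε > 0`. -/
noncomputable def shiftedSquare (R : X →L[ℝ] X) (ε : ℝ) : X →L[ℝ] X := ε • 1 - R * R

/-- `-R (ε - R²)⁻¹`, a bounded skew approximation of `R⁻¹` as `ε → 0`. -/
noncomputable def approxInverse (R : X →L[ℝ] X) (ε : ℝ) : X →L[ℝ] X :=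
  -(R * Ring.inverse (shiftedSquare R ε))

theorem IsSkew.inner_shiftedSquare {R : X →L[ℝ] X} (hR : IsSkew R) (ε : ℝ) (x : X) :
    inner ℝ (shiftedSquare R ε x) x = ε * ‖x‖ ^ 2 + ‖R x‖ ^ 2 := by
  simp only [shiftedSquare, sub_apply, smul_apply,
    one_apply_eq_self, mul_apply_eq_comp, inner_sub_left,
    real_inner_smul_left, hR (R x) x, real_inner_self_eq_norm_sq]
  ring

theorem commute_shiftedSquare (R : X →L[ℝ] X) (ε : ℝ) : Commute R (shiftedSquare R ε) :=
  ((Commute.one_right R).smul_right ε).sub_right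
    ((Commute.refl R).mul_right (Commute.refl R))

theorem Commute.ringInverse_right {M : Type*} [MonoidWithZero M] {a b : M} (h : Commute a b) :
    Commute a (Ring.inverse b) := by
  by_cases hb : IsUnit b
  · obtain ⟨v, rfl⟩ := hb
    rw [Ring.inverse_unit]
    exact h.units_inv_right
  · rw [Ring.inverse_non_unit _ hb]
    exact Commute.zero_right a

theorem commute_shiftedSquare_inverse (R : X →L[ℝ] X) (ε : ℝ) :
    Commute R (Ring.inverse (shiftedSquare R ε)) :=
  (commute_shiftedSquare R ε).ringInverse_right

theorem commute_approxInverse_self (R : X →L[ℝ] X) (ε : ℝ) : Commute R (approxInverse R ε) :=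
  ((Commute.refl R).mul_right (commute_shiftedSquare_inverse R ε)).neg_right

theorem commute_approxInverse (R : X →L[ℝ] X) (ε δ : ℝ) :
    Commute (approxInverse R ε) (approxInverse R δ) := by
  have h : Commute (approxInverse R ε) (shiftedSquare R δ) := by
    have h1 := (commute_approxInverse_self R ε).symm
    exact ((Commute.one_right _).smul_right δ).sub_right (h1.mul_right h1)
  exact ((commute_approxInverse_self R ε).symm.mul_right h.ringInverse_right).neg_right

variable [CompleteSpace X]

theorem hasDerivAt_exp_smul_apply (B : X →L[ℝ] X) (x : X) (t : ℝ) :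
    HasDerivAt (fun s : ℝ => NormedSpace.exp (s • B) x) (NormedSpace.exp (t • B) (B x)) t :=
  (hasDerivAt_exp_smul_const (𝕂 := ℝ) B t).clm_apply (hasDerivAt_const t x) |>.congr_deriv
    (by simp)

theorem hasDerivAt_exp_smul_apply' (B : X →L[ℝ] X) (x : X) (t : ℝ) :
    HasDerivAt (fun s : ℝ => NormedSpace.exp (s • B) x) (B (NormedSpace.exp (t • B) x)) t :=
  (hasDerivAt_exp_smul_const' (𝕂 := ℝ) B t).clm_apply (hasDerivAt_const t x) |>.congr_deriv
    (by simp)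

theorem continuous_exp_smul_apply (B : X →L[ℝ] X) (x : X) :
    Continuous fun s : ℝ => NormedSpace.exp (s • B) x :=
  continuous_iff_continuousAt.2 fun t => (hasDerivAt_exp_smul_apply B x t).continuousAt

theorem IsSkew.norm_exp_smul_apply {B : X →L[ℝ] X} (hB : IsSkew B) (t : ℝ) (x : X) :
    ‖NormedSpace.exp (t • B) x‖ = ‖x‖ := by
  have hd : ∀ s : ℝ, HasDerivAt (fun s : ℝ => ‖NormedSpace.exp (s • B) x‖ ^ 2) 0 s := fun s => by
    simpa [hB.inner_self] using (hasDerivAt_exp_smul_apply' B x s).norm_sq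
  have h := is_const_of_deriv_eq_zero (fun s => (hd s).differentiableAt)
    (fun s => (hd s).deriv) t 0
  simpa [NormedSpace.exp_zero] using h

theorem IsSkew.norm_exp_smul_apply_sub_le {B : X →L[ℝ] X} (hB : IsSkew B) (t : ℝ) (x : X) :
    ‖NormedSpace.exp (t • B) x - x‖ ≤ ‖B x‖ * |t| := by
  have h := convex_univ.norm_image_sub_le_of_norm_hasDerivWithin_le (𝕜 := ℝ)
    (f := fun s : ℝ => NormedSpace.exp (s • B) x) (C := ‖B x‖)
    (fun s _ => (hasDerivAt_exp_smul_apply B x s).hasDerivWithinAt)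
    (fun s _ => (hB.norm_exp_smul_apply s (B x)).le) (mem_univ 0) (mem_univ t)
  simpa [NormedSpace.exp_zero] using h

/-- For commuting skew operators, `exp (tB) = exp (t(B - C)) exp (tC)` with isometric factors. -/
theorem IsSkew.norm_exp_smul_apply_sub_exp_le {B C : X →L[ℝ] X} (hB : IsSkew B) (hC : IsSkew C)
    (hBC : Commute B C) (t : ℝ) (x : X) :
    ‖NormedSpace.exp (t • B) x - NormedSpace.exp (t • C) x‖ ≤ ‖B x - C x‖ * |t| := by
  have hc : Commute (t • C) (t • (B - C)) :=
    ((hBC.symm.sub_right (Commute.refl C)).smul_right t).smul_left t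
  have he : NormedSpace.exp (t • B) =
      NormedSpace.exp (t • C) * NormedSpace.exp (t • (B - C)) := by
    let : NormedAlgebra ℚ (X →L[ℝ] X) := NormedAlgebra.restrictScalars ℚ ℝ _
    rw [← NormedSpace.exp_add_of_commute hc]
    congr 1
    module
  rw [he, mul_apply_eq_comp, ← map_sub, hC.norm_exp_smul_apply]
  exact (hB.sub hC).norm_exp_smul_apply_sub_le t x

theorem IsSkew.isUnit_shiftedSquare {R : X →L[ℝ] X} (hR : IsSkew R) {ε : ℝ} (hε : 0 < ε) :
    IsUnit (shiftedSquare R ε) := by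
  refine ContinuousLinearMap.isUnit_of_forall_le_norm_inner_map _ (c := ⟨ε, hε.le⟩) hε fun x => ?_
  rw [hR.inner_shiftedSquare, Real.norm_of_nonneg (by positivity)]
  change ‖x‖ ^ 2 * ε ≤ _
  nlinarith [sq_nonneg ‖R x‖]

theorem IsSkew.shiftedSquare_inverse_apply {R : X →L[ℝ] X} (hR : IsSkew R) {ε : ℝ} (hε : 0 < ε)
    (x : X) : shiftedSquare R ε (Ring.inverse (shiftedSquare R ε) x) = x := by
  rw [← mul_apply_eq_comp, Ring.mul_inverse_cancel _ (hR.isUnit_shiftedSquare hε)]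
  rfl

theorem IsSkew.approxInverse {R : X →L[ℝ] X} (hR : IsSkew R) {ε : ℝ} (hε : 0 < ε) :
    IsSkew (approxInverse R ε) := by
  have hsymm : ∀ x y, inner ℝ (shiftedSquare R ε x) y = inner ℝ x (shiftedSquare R ε y) := by
    intro x y
    simp only [shiftedSquare, sub_apply, smul_apply,
      one_apply_eq_self, mul_apply_eq_comp, inner_sub_left,
      inner_sub_right, real_inner_smul_left, real_inner_smul_right, hR (R x) y, hR x (R y), neg_neg]
  have hinv : ∀ x y, inner ℝ (Ring.inverse (shiftedSquare R ε) x) y =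
      inner ℝ x (Ring.inverse (shiftedSquare R ε) y) := by
    intro x y
    conv_lhs => rw [← hR.shiftedSquare_inverse_apply hε y, ← hsymm,
      hR.shiftedSquare_inverse_apply hε x]
  intro x y
  have hc : R (Ring.inverse (shiftedSquare R ε) y) = Ring.inverse (shiftedSquare R ε) (R y) :=
    DFunLike.congr_fun (commute_shiftedSquare_inverse R ε).eq y
  simp only [_root_.approxInverse, neg_apply, mul_apply_eq_comp,
    inner_neg_left, inner_neg_right, hR _ y, hinv, hc]

theorem IsSkew.apply_approxInverse {R : X →L[ℝ] X} (hR : IsSkew R) {ε : ℝ} (hε : 0 < ε) (x : X) :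
    R (_root_.approxInverse R ε x) = x - ε • Ring.inverse (shiftedSquare R ε) x := by
  have h := hR.shiftedSquare_inverse_apply hε x
  conv_rhs => rw [← h]
  conv_rhs => enter [2]; rw [h]
  simp [_root_.approxInverse, shiftedSquare]

theorem IsSkew.norm_smul_inverse_le {R : X →L[ℝ] X} (hR : IsSkew R) {ε : ℝ} (hε : 0 < ε) (x : X) :
    ‖ε • Ring.inverse (shiftedSquare R ε) x‖ ≤ ‖x‖ := by
  set k := Ring.inverse (shiftedSquare R ε) x with hk
  have h := hR.inner_shiftedSquare ε k
  rw [hk, hR.shiftedSquare_inverse_apply hε x, ← hk] at h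
  have h1 := real_inner_le_norm x k
  rw [norm_smul, Real.norm_of_nonneg hε.le]
  rcases eq_or_lt_of_le (norm_nonneg k) with h0 | h0
  · rw [← h0]; simp
  · nlinarith [sq_nonneg ‖R k‖]

theorem IsSkew.norm_smul_inverse_apply_le {R : X →L[ℝ] X} (hR : IsSkew R) {ε : ℝ} (hε : 0 < ε)
    (x : X) : ‖ε • Ring.inverse (shiftedSquare R ε) (R x)‖ ≤ √ε * ‖x‖ := by
  have hc : R (Ring.inverse (shiftedSquare R ε) x) = Ring.inverse (shiftedSquare R ε) (R x) :=
    DFunLike.congr_fun (commute_shiftedSquare_inverse R ε).eq x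
  rw [← hc]
  have h2 := hR.norm_smul_inverse_le hε x
  set k := Ring.inverse (shiftedSquare R ε) x with hk
  have h := hR.inner_shiftedSquare ε k
  rw [hk, hR.shiftedSquare_inverse_apply hε x, ← hk] at h
  have h1 := real_inner_le_norm x k
  rw [norm_smul, Real.norm_of_nonneg hε.le] at h2 ⊢
  refine le_of_sq_le_sq ?_ (by positivity)
  rw [mul_pow, mul_pow, Real.sq_sqrt hε.le]
  have h3 : ‖R k‖ ^ 2 ≤ ‖x‖ * ‖k‖ := by nlinarith [sq_nonneg ‖k‖]
  calc ε ^ 2 * ‖R k‖ ^ 2 ≤ ε ^ 2 * (‖x‖ * ‖k‖) := by gcongr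
    _ = ε * (‖x‖ * (ε * ‖k‖)) := by ring
    _ ≤ ε * (‖x‖ * ‖x‖) := by gcongr
    _ = ε * ‖x‖ ^ 2 := by ring

theorem IsSkew.denseRange {R : X →L[ℝ] X} (hR : IsSkew R) (hinj : ∀ x, R x = 0 → x = 0) :
    DenseRange R := by
  have h : (LinearMap.range (R : X →ₗ[ℝ] X)).topologicalClosure = ⊤ := by
    rw [Submodule.topologicalClosure_eq_top_iff, Submodule.eq_bot_iff]
    intro x hx
    refine hinj x (inner_self_eq_zero (𝕜 := ℝ).1 ?_)
    have h1 := (Submodule.mem_orthogonal _ _).1 hx (R (R x)) ⟨R x, rfl⟩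
    rw [hR] at h1
    linarith
  have := (Submodule.dense_iff_topologicalClosure_eq_top).2 h
  exact this

/-- `ε (ε - R²)⁻¹ → 0` strongly: uniformly bounded, and `O(√ε)` on the dense range of `R`. -/
theorem IsSkew.tendsto_apply_approxInverse {R : X →L[ℝ] X} (hR : IsSkew R)
    (hinj : ∀ x, R x = 0 → x = 0) (x : X) :
    Tendsto (fun ε => R (_root_.approxInverse R ε x)) (𝓝[>] 0) (𝓝 x) := by
  rw [Metric.tendsto_nhds]
  intro η hη
  obtain ⟨z, hz⟩ := (hR.denseRange hinj).exists_dist_lt x (half_pos hη)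
  have hs : Tendsto (fun ε : ℝ => √ε * ‖z‖) (𝓝[>] 0) (𝓝 0) := by
    have : Tendsto (fun ε : ℝ => √ε * ‖z‖) (𝓝 0) (𝓝 (√0 * ‖z‖)) :=
      (Real.continuous_sqrt.mul continuous_const).tendsto 0
    rw [Real.sqrt_zero, zero_mul] at this
    exact this.mono_left nhdsWithin_le_nhds
  filter_upwards [self_mem_nhdsWithin, hs.eventually_lt_const (half_pos hη)] with ε hε hsε
  rw [hR.apply_approxInverse hε, dist_eq_norm, sub_sub_cancel_left, norm_neg]
  have hsplit : ε • Ring.inverse (shiftedSquare R ε) x =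
      ε • Ring.inverse (shiftedSquare R ε) (x - R z) +
        ε • Ring.inverse (shiftedSquare R ε) (R z) := by
    rw [← smul_add, ← map_add, sub_add_cancel]
  rw [hsplit]
  have h1 := hR.norm_smul_inverse_le hε (x - R z)
  have h2 := hR.norm_smul_inverse_apply_le hε z
  rw [dist_eq_norm] at hz
  linarith [norm_add_le (ε • Ring.inverse (shiftedSquare R ε) (x - R z))
    (ε • Ring.inverse (shiftedSquare R ε) (R z))]

/-- The approximate trajectories `exp (t B_n) x` are uniformly Cauchy on bounded sets of times when
`B_n` are commuting skew operators that converge strongly on a dense set. -/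
theorem IsSkew.uniformCauchySeqOn_exp {B : ℕ → X →L[ℝ] X} (hB : ∀ n, IsSkew (B n))
    (hcomm : ∀ m n, Commute (B m) (B n)) {D : Set X} (hD : Dense D)
    (hconv : ∀ z ∈ D, CauchySeq fun n => B n z) (x : X) (T : ℝ) :
    UniformCauchySeqOn (fun n (t : ℝ) => NormedSpace.exp (t • B n) x) atTop {t | |t| ≤ T} := by
  rw [Metric.uniformCauchySeqOn_iff]
  intro η hη
  obtain ⟨z, hzD, hz⟩ := hD.exists_dist_lt x (show 0 < η / 3 by positivity)
  have hT : 0 < |T| + 1 := by positivity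
  obtain ⟨N, hN⟩ := Metric.cauchySeq_iff.1 (hconv z hzD) (η / 3 / (|T| + 1)) (by positivity)
  refine ⟨N, fun m hm n hn t ht => ?_⟩
  have h1 : ‖NormedSpace.exp (t • B m) (x - z)‖ = ‖x - z‖ := (hB m).norm_exp_smul_apply t _
  have h2 : ‖NormedSpace.exp (t • B n) (x - z)‖ = ‖x - z‖ := (hB n).norm_exp_smul_apply t _
  have h3 := (hB m).norm_exp_smul_apply_sub_exp_le (hB n) (hcomm m n) t z
  have h4 := hN m hm n hn
  rw [dist_eq_norm] at h4 hz ⊢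
  have h5 : ‖B m z - B n z‖ * |t| ≤ η / 3 := by
    have ht' : |t| ≤ |T| + 1 := by
      have : |t| ≤ T := ht
      linarith [le_abs_self T]
    calc ‖B m z - B n z‖ * |t| ≤ (η / 3 / (|T| + 1)) * (|T| + 1) := by gcongr
      _ = η / 3 := by field_simp
  have hsplit : NormedSpace.exp (t • B m) x - NormedSpace.exp (t • B n) x =
      NormedSpace.exp (t • B m) (x - z) - NormedSpace.exp (t • B n) (x - z) +
        (NormedSpace.exp (t • B m) z - NormedSpace.exp (t • B n) z) := by
    simp only [map_sub]; abel
  rw [hsplit]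
  have h6 := norm_add_le (NormedSpace.exp (t • B m) (x - z) - NormedSpace.exp (t • B n) (x - z))
    (NormedSpace.exp (t • B m) z - NormedSpace.exp (t • B n) z)
  have h7 := norm_sub_le (NormedSpace.exp (t • B m) (x - z)) (NormedSpace.exp (t • B n) (x - z))
  linarith

/-- Existence for `U' = R⁻¹ U` in integrated form, `R (U t - U 0) = ∫₀ᵗ U`, with conservation of the
norm. The operator `R⁻¹` is the skew-adjoint generator; only its bounded inverse is used. -/
theorem IsSkew.exists_trajectory {R : X →L[ℝ] X} (hR : IsSkew R) (hinj : ∀ x, R x = 0 → x = 0)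
    (x : X) : ∃ u : ℝ → X, Continuous u ∧ u 0 = x ∧ (∀ t, ‖u t‖ = ‖x‖) ∧
      ∀ t, R (u t - x) = ∫ s in (0 : ℝ)..t, u s := by
  obtain ⟨e, -, hepos, helim⟩ := exists_seq_strictAnti_tendsto (0 : ℝ)
  have helim' : Tendsto e atTop (𝓝[>] 0) :=
    tendsto_nhdsWithin_iff.2 ⟨helim, Eventually.of_forall hepos⟩
  set B : ℕ → X →L[ℝ] X := fun n => _root_.approxInverse R (e n) with hBdef
  have hB : ∀ n, IsSkew (B n) := fun n => hR.approxInverse (hepos n)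
  have hRB : ∀ z, Tendsto (fun n => R (B n z)) atTop (𝓝 z) := fun z =>
    (hR.tendsto_apply_approxInverse hinj z).comp helim'
  have hcomm : ∀ n y, R (B n y) = B n (R y) := fun n y =>
    DFunLike.congr_fun (commute_approxInverse_self R (e n)).eq y
  -- On the range of `R`, the approximations `B_n R z = R B_n z` converge to `z`.
  have hconv : ∀ z ∈ range R, CauchySeq fun n => B n z := by
    rintro _ ⟨z, rfl⟩
    simpa only [← hcomm] using (hRB z).cauchySeq
  have hcau := fun T => IsSkew.uniformCauchySeqOn_exp hB
    (fun m n => commute_approxInverse R (e m) (e n)) (hR.denseRange hinj) hconv x T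
  have hlim : ∀ t : ℝ, ∃ y, Tendsto (fun n => NormedSpace.exp (t • B n) x) atTop (𝓝 y) := fun t =>
    cauchySeq_tendsto_of_complete ((hcau |t|).cauchySeq (x := t) (le_refl |t|))
  choose u hu using hlim
  have hunif : ∀ T : ℝ, TendstoUniformlyOn (fun n (t : ℝ) => NormedSpace.exp (t • B n) x) u atTop
      {t | |t| ≤ T} := fun T => (hcau T).tendstoUniformlyOn_of_tendsto fun t _ => hu t
  have hcont : Continuous u := by
    rw [continuous_iff_continuousAt]
    intro t
    have hn : {s : ℝ | |s| ≤ |t| + 1} ∈ 𝓝 t := by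
      have : {s : ℝ | |s| < |t| + 1} ∈ 𝓝 t :=
        (isOpen_lt continuous_abs continuous_const).mem_nhds (by simp)
      exact mem_of_superset this fun s (hs : |s| < |t| + 1) => hs.le
    exact ((hunif (|t| + 1)).continuousOn
      (Frequently.of_forall fun n => (continuous_exp_smul_apply (B n) x).continuousOn)).continuousAt
      hn
  refine ⟨u, hcont, ?_, fun t => ?_, fun t => ?_⟩
  · refine tendsto_nhds_unique (hu 0) ?_
    simp [NormedSpace.exp_zero]
  · refine tendsto_nhds_unique (hu t).norm ?_
    simp [(hB _).norm_exp_smul_apply]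
  -- The approximate trajectories satisfy `R (U_n t - x) = ∫₀ᵗ exp (s B_n) (R B_n x) ds`, and
  -- `R B_n x → x`.
  · have hn : ∀ n, R (NormedSpace.exp (t • B n) x - x) =
        ∫ s in (0 : ℝ)..t, NormedSpace.exp (s • B n) (R (B n x)) := by
      intro n
      have hd : ∀ s : ℝ, HasDerivAt (fun s : ℝ => R (NormedSpace.exp (s • B n) x))
          (NormedSpace.exp (s • B n) (R (B n x))) s := by
        intro s
        have h1 := R.hasFDerivAt.comp_hasDerivAt s (hasDerivAt_exp_smul_apply (B n) x s)
        have h2 : Commute R (NormedSpace.exp (s • B n)) :=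
          ((commute_approxInverse_self R (e n)).smul_right s).exp_right
        exact h1.congr_deriv (DFunLike.congr_fun h2.eq (B n x))
      rw [intervalIntegral.integral_eq_sub_of_hasDerivAt (fun s _ => hd s)
        ((continuous_exp_smul_apply _ _).intervalIntegrable _ _), map_sub]
      simp [NormedSpace.exp_zero]
    refine tendsto_nhds_unique
      ((R.continuous.tendsto _).comp ((hu t).sub_const x)) ?_
    change Tendsto (fun n => R (NormedSpace.exp (t • B n) x - x)) atTop _
    simp only [hn]
    refine intervalIntegral.tendsto_integral_filter_of_dominated_convergence
      (fun _ => ‖x‖ + 1) ?_ ?_ (by simp) ?_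
    · exact Eventually.of_forall fun n => (continuous_exp_smul_apply _ _).aestronglyMeasurable
    · filter_upwards [(hRB x).norm.eventually_le_const (lt_add_one ‖x‖)] with n hn
      exact Eventually.of_forall fun s _ => ((hB n).norm_exp_smul_apply s _).le.trans hn
    · refine Eventually.of_forall fun s _ => ?_
      have h1 : Tendsto (fun n => NormedSpace.exp (s • B n) (R (B n x) - x)) atTop (𝓝 0) := by
        rw [tendsto_zero_iff_norm_tendsto_zero]
        simp only [(hB _).norm_exp_smul_apply]
        simpa using ((hRB x).sub_const x).norm
      simpa [map_sub] using h1.add (hu s)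

/-- Uniqueness for `U' = R⁻¹ U` in integrated form on `[0,∞)`: `w = ∫₀ᵗ U` satisfies `w = R w'`, so
`‖w‖` is constant. -/
theorem IsSkew.trajectory_eq_zero {R : X →L[ℝ] X} (hR : IsSkew R) (hinj : ∀ x, R x = 0 → x = 0)
    {u : ℝ → X} (hu : ContinuousOn u (Ici 0))
    (h : ∀ t, 0 ≤ t → R (u t) = ∫ s in (0 : ℝ)..t, u s) {t : ℝ} (ht : 0 ≤ t) : u t = 0 := by
  refine hinj _ ?_
  have hint : ∀ b, 0 ≤ b → IntervalIntegrable u volume 0 b := fun b hb =>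
    (hu.mono (by rw [uIcc_of_le hb]; exact Icc_subset_Ici_self)).intervalIntegrable
  set w : ℝ → X := fun t => ∫ s in (0 : ℝ)..t, u s with hw
  have hd : ∀ s ∈ Ici (0 : ℝ), HasDerivWithinAt w (u s) (Ici s) s := by
    intro s hs
    have hsub : Ici s ⊆ Ici (0 : ℝ) := Ici_subset_Ici.2 hs
    refine intervalIntegral.integral_hasDerivWithinAt_right (hint s hs)
      (t := Ioi s) ?_ ((hu s hs).mono (Ioi_subset_Ici_self.trans hsub))
    exact (hu.mono hsub).stronglyMeasurableAtFilter_nhdsWithin measurableSet_Ici s |>.filter_mono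
      (nhdsWithin_mono _ Ioi_subset_Ici_self)
  have hwc : ContinuousOn w (Icc 0 t) := by
    have := intervalIntegral.continuousOn_primitive_interval' (hint t ht)
      (left_mem_uIcc (a := (0 : ℝ)) (b := t))
    rwa [uIcc_of_le ht] at this
  have hconst := constant_of_has_deriv_right_zero (f := fun s => ‖w s‖ ^ 2) (hwc.norm.pow 2)
    (fun s hs => by
      have h1 := (hd s hs.1).norm_sq
      have h2 : w s = R (u s) := (h s hs.1).symm
      have h3 : inner ℝ (w s) (u s) = 0 := by
        rw [h2, hR, hR.inner_self, neg_zero]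
      simpa [h3] using h1) t (right_mem_Icc.2 ht)
  have h0 : w 0 = 0 := by simp [hw]
  simp only [h0] at hconst
  rw [h t ht]
  simpa using hconst

theorem IsSkew.trajectory_unique {R : X →L[ℝ] X} (hR : IsSkew R) (hinj : ∀ x, R x = 0 → x = 0)
    {u v : ℝ → X} (hu : ContinuousOn u (Ici 0)) (hv : ContinuousOn v (Ici 0)) (h0 : u 0 = v 0)
    (hRu : ∀ t, 0 ≤ t → R (u t - u 0) = ∫ s in (0 : ℝ)..t, u s)
    (hRv : ∀ t, 0 ≤ t → R (v t - v 0) = ∫ s in (0 : ℝ)..t, v s) {t : ℝ} (ht : 0 ≤ t) :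
    u t = v t := by
  refine sub_eq_zero.1 (hR.trajectory_eq_zero hinj (hu.sub hv) (fun t ht => ?_) ht)
  have hsub : uIcc 0 t ⊆ Ici (0 : ℝ) := by
    rw [uIcc_of_le ht]
    exact Icc_subset_Ici_self
  change R (u t - v t) = ∫ s in (0 : ℝ)..t, (u s - v s)
  rw [intervalIntegral.integral_sub (hu.mono hsub).intervalIntegrable
    (hv.mono hsub).intervalIntegrable, ← hRu t ht, ← hRv t ht, ← map_sub, h0]
  congr 1
  abel

/-- Any trajectory conserves the norm, since it is the one constructed in
`IsSkew.exists_trajectory`. -/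
theorem IsSkew.norm_trajectory {R : X →L[ℝ] X} (hR : IsSkew R) (hinj : ∀ x, R x = 0 → x = 0)
    {u : ℝ → X} (hu : ContinuousOn u (Ici 0))
    (hRu : ∀ t, 0 ≤ t → R (u t - u 0) = ∫ s in (0 : ℝ)..t, u s) {t : ℝ} (ht : 0 ≤ t) :
    ‖u t‖ = ‖u 0‖ := by
  obtain ⟨v, hv, hv0, hvn, hRv⟩ := hR.exists_trajectory hinj (u 0)
  rw [hR.trajectory_unique hinj hu hv.continuousOn hv0.symm hRu
    (fun s _ => by rw [hv0]; exact hRv s) ht, hvn]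

end SkewOperators

/-! ### Primitives of integrable functions on `(0,1)` -/

section Primitives

/-- The primitive `x ↦ ∫₀ˣ g`. -/
noncomputable def primitive (g : ℝ → ℝ) (x : ℝ) : ℝ := ∫ s in (0 : ℝ)..x, g s

@[simp] theorem primitive_zero (g : ℝ → ℝ) : primitive g 0 = 0 := by simp [primitive]

theorem integral_unitMeasure (g : ℝ → ℝ) : ∫ x, g x ∂unitMeasure = ∫ x in (0 : ℝ)..1, g x := by
  rw [intervalIntegral.integral_of_le zero_le_one, integral_Ioc_eq_integral_Ioo]

theorem primitive_one (g : ℝ → ℝ) : primitive g 1 = ∫ x, g x ∂unitMeasure :=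
  (integral_unitMeasure g).symm

theorem intervalIntegrable_of_unitMeasure {g : ℝ → ℝ} (hg : Integrable g unitMeasure) :
    IntervalIntegrable g volume 0 1 :=
  (intervalIntegrable_iff_integrableOn_Ioo_of_le zero_le_one).2 hg

theorem continuousOn_primitive {g : ℝ → ℝ} (hg : Integrable g unitMeasure) :
    ContinuousOn (primitive g) (Icc 0 1) := by
  have h := intervalIntegral.continuousOn_primitive_interval' (intervalIntegrable_of_unitMeasure hg)
    (left_mem_uIcc (a := (0 : ℝ)) (b := 1))
  rwa [uIcc_of_le zero_le_one] at h

theorem integrable_of_continuousOn {f : ℝ → ℝ} (hf : ContinuousOn f (Icc 0 1)) :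
    Integrable f unitMeasure :=
  (hf.integrableOn_Icc (μ := volume)).mono_set Ioo_subset_Icc_self

theorem integrable_primitive {g : ℝ → ℝ} (hg : Integrable g unitMeasure) :
    Integrable (primitive g) unitMeasure :=
  integrable_of_continuousOn (continuousOn_primitive hg)

theorem primitive_congr {f g : ℝ → ℝ} (h : f =ᵐ[unitMeasure] g) {x : ℝ} (hx : x ∈ Icc (0 : ℝ) 1) :
    primitive f x = primitive g x := by
  have h' : f =ᵐ[volume.restrict (Ioc 0 1)] g := by
    rwa [← restrict_Ioo_eq_restrict_Ioc]
  refine intervalIntegral.integral_congr_ae ?_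
  rw [uIoc_of_le hx.1]
  filter_upwards [(ae_restrict_iff' measurableSet_Ioc).1 h'] with y hy hyx
  exact hy ⟨hyx.1, hyx.2.trans hx.2⟩

theorem abs_primitive_le {g : ℝ → ℝ} {C : ℝ} (hC : ∀ s ∈ Icc (0 : ℝ) 1, |g s| ≤ C) {x : ℝ}
    (hx : x ∈ Icc (0 : ℝ) 1) : |primitive g x| ≤ C * x := by
  have h := intervalIntegral.norm_integral_le_of_norm_le_const (f := g) (a := 0) (b := x) (C := C)
    (fun s hs => by
      rw [uIoc_of_le hx.1] at hs
      exact hC s ⟨hs.1.le, hs.2.trans hx.2⟩)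
  simpa [primitive, abs_of_nonneg hx.1] using h

theorem abs_primitive_le_integral {g : ℝ → ℝ} (hg : Integrable g unitMeasure) {x : ℝ}
    (hx : x ∈ Icc (0 : ℝ) 1) : |primitive g x| ≤ ∫ s, |g s| ∂unitMeasure := by
  rw [integral_unitMeasure]
  refine (intervalIntegral.abs_integral_le_integral_abs hx.1).trans ?_
  exact intervalIntegral.integral_mono_interval le_rfl hx.1 hx.2
    (Filter.Eventually.of_forall fun s => abs_nonneg _)
    (intervalIntegrable_of_unitMeasure hg.abs)

/-- Integration by parts on `(0,1)` for the absolutely continuous function `∫₀ˣ g`. -/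
theorem integral_primitive_mul_deriv {g ψ : ℝ → ℝ} (hg : Integrable g unitMeasure)
    (hψ : ContDiff ℝ 1 ψ) :
    ∫ x, primitive g x * deriv ψ x ∂unitMeasure =
      (∫ x, g x ∂unitMeasure) * ψ 1 - ∫ x, g x * ψ x ∂unitMeasure := by
  have hi := intervalIntegrable_of_unitMeasure hg
  have h0 : (0 : ℝ) ∈ uIcc (0 : ℝ) 1 := left_mem_uIcc
  have h := (hi.absolutelyContinuousOnInterval_intervalIntegral
    h0).integral_mul_deriv_eq_deriv_mul hψ.contDiffOn.absolutelyContinuousOnInterval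
  simp only [integral_unitMeasure]
  rw [show (∫ x in (0 : ℝ)..1, primitive g x * deriv ψ x) = _ from h]
  simp only [intervalIntegral.integral_same, zero_mul, sub_zero]
  congr 1
  refine intervalIntegral.integral_congr_ae ?_
  filter_upwards [hi.ae_hasDerivAt_integral] with x hx hx'
  rw [(hx (uIoc_subset_uIcc hx') 0 h0).deriv]

theorem integral_primitive {g : ℝ → ℝ} (hg : Integrable g unitMeasure) :
    ∫ x, primitive g x ∂unitMeasure =
      (∫ x, g x ∂unitMeasure) - ∫ x, g x * x ∂unitMeasure := by
  simpa using integral_primitive_mul_deriv hg (ψ := fun x => x) contDiff_id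

end Primitives

/-! ### Test functions and du Bois-Reymond lemmas -/

section TestFunctions

theorem IsTestFunction.contDiff_one {φ : ℝ → ℝ} (h : IsTestFunction φ) : ContDiff ℝ 1 φ :=
  h.1.of_le (by exact_mod_cast le_top)

theorem IsTestFunction.eq_zero {φ : ℝ → ℝ} (h : IsTestFunction φ) {x : ℝ}
    (hx : x ∉ Ioo (0 : ℝ) 1) : φ x = 0 :=
  image_eq_zero_of_notMem_tsupport fun hx' => hx (h.2.2 hx')

theorem IsTestFunction.deriv {φ : ℝ → ℝ} (h : IsTestFunction φ) : IsTestFunction (deriv φ) :=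
  ⟨(contDiff_infty_iff_deriv.1 h.1).2, h.2.1.deriv, tsupport_deriv_subset.trans h.2.2⟩

theorem IsTestFunction.sub_const_mul {φ χ : ℝ → ℝ} (h : IsTestFunction φ) (h' : IsTestFunction χ)
    (c : ℝ) : IsTestFunction (fun x => φ x - c * χ x) := by
  have hsub : tsupport (fun x => φ x - c * χ x) ⊆ tsupport φ ∪ tsupport χ := by
    refine closure_minimal (fun x hx => ?_) ((isClosed_tsupport φ).union (isClosed_tsupport χ))
    by_contra hn
    rw [mem_union, not_or] at hn
    exact hx (by simp [image_eq_zero_of_notMem_tsupport hn.1, image_eq_zero_of_notMem_tsupport hn.2])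
  exact ⟨h.1.sub (contDiff_const.mul h'.1),
    (h.2.1.isCompact.union h'.2.1.isCompact).of_isClosed_subset (isClosed_tsupport _) hsub,
    hsub.trans (union_subset h.2.2 h'.2.2)⟩

theorem IsTestFunction.integrable {φ : ℝ → ℝ} (h : IsTestFunction φ) : Integrable φ unitMeasure :=
  integrable_of_continuousOn h.1.continuous.continuousOn

theorem IsTestFunction.primitive_deriv {φ : ℝ → ℝ} (h : IsTestFunction φ) :
    primitive (_root_.deriv φ) = φ := by
  ext x
  rw [primitive, intervalIntegral.integral_deriv_eq_sub
    (fun y _ => h.contDiff_one.differentiable one_ne_zero y)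
    (h.deriv.1.continuous.intervalIntegrable _ _), h.eq_zero (x := 0) (by simp), sub_zero]

theorem IsTestFunction.integral_deriv {φ : ℝ → ℝ} (h : IsTestFunction φ) :
    ∫ x, _root_.deriv φ x ∂unitMeasure = 0 := by
  rw [← primitive_one, h.primitive_deriv, h.eq_zero (by simp)]

theorem IsTestFunction.deriv_primitive {φ : ℝ → ℝ} (h : IsTestFunction φ) :
    _root_.deriv (primitive φ) = φ := by
  ext x
  exact h.1.continuous.deriv_integral φ 0 x

theorem IsTestFunction.primitive {φ : ℝ → ℝ} (h : IsTestFunction φ)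
    (h0 : ∫ x, φ x ∂unitMeasure = 0) : IsTestFunction (primitive φ) := by
  -- The point `1 / 2` is added so that the least and greatest elements exist when `φ = 0`.
  have hK : IsCompact (insert (1 / 2 : ℝ) (tsupport φ)) := h.2.1.isCompact.insert _
  have hsub : insert (1 / 2 : ℝ) (tsupport φ) ⊆ Ioo 0 1 :=
    insert_subset (by norm_num) h.2.2
  obtain ⟨c, hc, hcl⟩ := hK.exists_isLeast (insert_nonempty _ _)
  obtain ⟨d, hd, hdl⟩ := hK.exists_isGreatest (insert_nonempty _ _)
  have hφ : ∀ x, x ∉ Icc c d → φ x = 0 := fun x hx =>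
    image_eq_zero_of_notMem_tsupport fun hx' =>
      hx ⟨hcl (mem_insert_of_mem _ hx'), hdl (mem_insert_of_mem _ hx')⟩
  have hc0 := (hsub hc).1
  have hd1 := (hsub hd).2
  have hsupp : tsupport (_root_.primitive φ) ⊆ Icc c d := by
    refine closure_minimal (fun x hx => ?_) isClosed_Icc
    by_contra hn
    refine hx ?_
    rcases lt_or_ge x c with hxc | hxc
    · refine intervalIntegral.integral_zero_ae (Filter.Eventually.of_forall fun y hy => hφ y ?_)
      rintro ⟨hy1, -⟩
      have : y ≤ max 0 x := hy.2
      rcases le_max_iff.1 this with h | h <;> linarith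
    · have hxd : d < x := not_le.1 fun h' => hn ⟨hxc, h'⟩
      have hi : ∀ u v : ℝ, IntervalIntegrable φ volume u v := fun u v =>
        h.1.continuous.intervalIntegrable u v
      rw [_root_.primitive, ← intervalIntegral.integral_add_adjacent_intervals (hi 0 1) (hi 1 x),
        ← integral_unitMeasure, h0, zero_add]
      refine intervalIntegral.integral_zero_ae (Filter.Eventually.of_forall fun y hy => hφ y ?_)
      rintro ⟨-, hy1⟩
      have : min 1 x < y := hy.1
      rcases min_lt_iff.1 this with h | h <;> linarith
  refine ⟨contDiff_infty_iff_deriv.2 ⟨fun x => ?_, ?_⟩,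
    isCompact_Icc.of_isClosed_subset (isClosed_tsupport _) hsupp,
    hsupp.trans fun x hx => ⟨hc0.trans_le hx.1, hx.2.trans_lt hd1⟩⟩
  · exact (intervalIntegral.integral_hasDerivAt_right (h.1.continuous.intervalIntegrable _ _)
      h.1.continuous.aestronglyMeasurable.stronglyMeasurableAtFilter
      h.1.continuous.continuousAt).differentiableAt
  · rw [h.deriv_primitive]
    exact h.1

theorem exists_isTestFunction_integral_eq_one :
    ∃ χ : ℝ → ℝ, IsTestFunction χ ∧ ∫ x, χ x ∂unitMeasure = 1 := by
  let b : ContDiffBump (1 / 2 : ℝ) := ⟨1 / 8, 1 / 4, by norm_num, by norm_num⟩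
  have hsub : tsupport (b.normed volume) ⊆ Ioo 0 1 := by
    rw [b.tsupport_normed_eq, Real.closedBall_eq_Icc]
    intro x hx
    have h1 := hx.1
    have h2 := hx.2
    simp only [b] at h1 h2
    constructor <;> linarith
  refine ⟨b.normed volume, ⟨b.contDiff_normed, b.hasCompactSupport_normed, hsub⟩, ?_⟩
  rw [setIntegral_eq_integral_of_forall_compl_eq_zero, b.integral_normed]
  exact fun x hx => image_eq_zero_of_notMem_tsupport fun hx' => hx (hsub hx')

/-- The fundamental lemma of the calculus of variations on `(0,1)`. -/
theorem ae_eq_zero_of_forall_isTestFunction {f : ℝ → ℝ} (hf : LocallyIntegrableOn f (Ioo 0 1))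
    (h : ∀ φ, IsTestFunction φ → ∫ x, f x * φ x ∂unitMeasure = 0) : f =ᵐ[unitMeasure] 0 := by
  have h' := isOpen_Ioo.ae_eq_zero_of_integral_contDiff_smul_eq_zero hf fun φ h1 h2 h3 => by
    rw [← h φ ⟨h1, h2, h3⟩, setIntegral_eq_integral_of_forall_compl_eq_zero]
    · simp only [smul_eq_mul, mul_comm]
    · exact fun x hx => by rw [IsTestFunction.eq_zero ⟨h1, h2, h3⟩ hx, mul_zero]
  exact (ae_restrict_iff' measurableSet_Ioo).2 h'

/-- Du Bois-Reymond: any test function is a multiple of a fixed one up to the derivative of a test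
function. -/
theorem ae_eq_const_of_forall_integral_mul_deriv {f : ℝ → ℝ}
    (hf : LocallyIntegrableOn f (Ioo 0 1))
    (h : ∀ φ, IsTestFunction φ → ∫ x, f x * deriv φ x ∂unitMeasure = 0) :
    ∃ c : ℝ, f =ᵐ[unitMeasure] fun _ => c := by
  obtain ⟨χ, hχ, hχ1⟩ := exists_isTestFunction_integral_eq_one
  have hfm : ∀ {φ}, IsTestFunction φ → Integrable (fun x => f x * φ x) unitMeasure := fun hφ =>
    HasWeakDeriv.integrable_mul hf hφ.1.continuous hφ.2.1 hφ.2.2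
  refine ⟨∫ x, f x * χ x ∂unitMeasure, ?_⟩
  set c := ∫ x, f x * χ x ∂unitMeasure with hc
  have hz := ae_eq_zero_of_forall_isTestFunction (f := fun x => f x - c)
    (hf.sub ((locallyIntegrable_const c).locallyIntegrableOn _)) fun φ hφ => by
      have h1 := hφ.sub_const_mul hχ (∫ x, φ x ∂unitMeasure)
      have h2 : ∫ x, (φ x - (∫ x, φ x ∂unitMeasure) * χ x) ∂unitMeasure = 0 := by
        rw [integral_sub hφ.integrable (hχ.integrable.const_mul _), integral_const_mul, hχ1, mul_one,
          sub_self]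
      have h3 := h _ (h1.primitive h2)
      rw [h1.deriv_primitive] at h3
      simp only [mul_sub, sub_mul, mul_left_comm (f _)] at h3 ⊢
      rw [integral_sub (hfm hφ) ((hfm hχ).const_mul _), integral_const_mul, ← hc] at h3
      rw [integral_sub (hfm hφ) (hφ.integrable.const_mul _), integral_const_mul]
      linarith
  filter_upwards [hz] with x hx
  exact sub_eq_zero.1 hx

/-- A function whose second weak derivative on `(0,1)` vanishes is affine. With `∫ χ = 1` and
`c = ∫ f χ'`, testing with the primitives of `φ - (∫ φ) χ` gives `(f + c x)' = 0`
weakly. -/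
theorem ae_eq_affine_of_forall_integral_mul_deriv_deriv {f : ℝ → ℝ}
    (hf : LocallyIntegrableOn f (Ioo 0 1))
    (h : ∀ φ, IsTestFunction φ → ∫ x, f x * deriv (deriv φ) x ∂unitMeasure = 0) :
    ∃ c d : ℝ, f =ᵐ[unitMeasure] fun x => c + d * x := by
  obtain ⟨χ, hχ, hχ1⟩ := exists_isTestFunction_integral_eq_one
  have hfm : ∀ {φ}, IsTestFunction φ → Integrable (fun x => f x * φ x) unitMeasure := fun hφ =>
    HasWeakDeriv.integrable_mul hf hφ.1.continuous hφ.2.1 hφ.2.2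
  set c := ∫ x, f x * deriv χ x ∂unitMeasure with hc
  have hx : ∀ {φ}, IsTestFunction φ → Integrable (fun x => x * φ x) unitMeasure := fun hφ =>
    integrable_of_continuousOn (continuous_id.mul hφ.1.continuous).continuousOn
  obtain ⟨d, hd⟩ := ae_eq_const_of_forall_integral_mul_deriv (f := fun x => f x + c * x)
    (hf.add ((continuous_const.mul continuous_id).locallyIntegrable.locallyIntegrableOn _))
    fun φ hφ => by
      have h1 := hφ.sub_const_mul hχ (∫ x, φ x ∂unitMeasure)
      have h2 : ∫ x, (φ x - (∫ x, φ x ∂unitMeasure) * χ x) ∂unitMeasure = 0 := by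
        rw [integral_sub hφ.integrable (hχ.integrable.const_mul _), integral_const_mul, hχ1, mul_one,
          sub_self]
      have h3 := h _ (h1.primitive h2)
      have h4 : deriv (fun x => φ x - (∫ x, φ x ∂unitMeasure) * χ x) =
          fun x => deriv φ x - (∫ x, φ x ∂unitMeasure) * deriv χ x := by
        ext x
        have hφd := hφ.contDiff_one.differentiable one_ne_zero x
        have hχd := hχ.contDiff_one.differentiable one_ne_zero x
        rw [deriv_fun_sub hφd (hχd.const_mul _), deriv_const_mul _ hχd]
      have h5 : ∫ x, x * deriv φ x ∂unitMeasure = -∫ x, φ x ∂unitMeasure := by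
        have h6 := integral_primitive hφ.deriv.integrable
        rw [hφ.primitive_deriv, hφ.integral_deriv] at h6
        simp only [mul_comm _ (deriv φ _)]
        linarith
      rw [h1.deriv_primitive, h4] at h3
      simp only [mul_sub, add_mul, mul_left_comm (f _), mul_assoc] at h3 ⊢
      rw [integral_sub (hfm hφ.deriv) ((hfm hχ.deriv).const_mul _), integral_const_mul, ← hc] at h3
      rw [integral_add (hfm hφ.deriv) ((hx hφ.deriv).const_mul _), integral_const_mul, h5]
      linarith
  -- `f + c x = d` almost everywhere.
  refine ⟨d, -c, ?_⟩
  filter_upwards [hd] with x hx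
  linarith

end TestFunctions

/-! ### Elements of `H²₀(0,1)` as double primitives -/

section ClampedSobolev

theorem MemLp.integrable_unitMeasure {g : ℝ → ℝ} (hg : MemLp g 2 unitMeasure) :
    Integrable g unitMeasure :=
  hg.integrable (by norm_num)

theorem ContinuousOn.locallyIntegrableOn_Ioo {f : ℝ → ℝ} (hf : ContinuousOn f (Icc 0 1)) :
    LocallyIntegrableOn f (Ioo 0 1) :=
  (hf.mono Ioo_subset_Icc_self).locallyIntegrableOn measurableSet_Ioo

/-- Functions in `L²` orthogonal to the affine functions are exactly the second derivatives of
elements of `H²₀`. This is one direction; the converse is `IsH20.eqOn_primitive_deriv`, `IsH20.eqOn_primitive`,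
`IsH20.integral_eq_zero` and `IsH20.integral_mul_id_eq_zero`. -/
theorem IsH20.of_moments {g : ℝ → ℝ} (hg : MemLp g 2 unitMeasure)
    (h0 : ∫ x, g x ∂unitMeasure = 0) (h1 : ∫ x, g x * x ∂unitMeasure = 0) :
    IsH20 (primitive (primitive g)) (primitive g) g := by
  have hi := MemLp.integrable_unitMeasure hg
  have hc1 := continuousOn_primitive hi
  have hi1 := integrable_primitive hi
  have hc0 := continuousOn_primitive hi1
  have hint : ∫ x, primitive g x ∂unitMeasure = 0 := by rw [integral_primitive hi, h0, h1, sub_zero]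
  have hw1 : ∀ φ, IsTestFunction φ →
      ∫ x, primitive (primitive g) x * deriv φ x ∂unitMeasure =
        -∫ x, primitive g x * φ x ∂unitMeasure := fun φ hφ => by
    rw [integral_primitive_mul_deriv hi1 hφ.contDiff_one, hint, zero_mul, zero_sub]
  have hw2 : ∀ φ, IsTestFunction φ → ∫ x, primitive g x * deriv φ x ∂unitMeasure =
        -∫ x, g x * φ x ∂unitMeasure := fun φ hφ => by
    rw [integral_primitive_mul_deriv hi hφ.contDiff_one, h0, zero_mul, zero_sub]
  refine ⟨hc0, hc1, hg, ⟨hc0.locallyIntegrableOn_Ioo, hc1.locallyIntegrableOn_Ioo, fun φ hφ => ?_⟩,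
    ⟨hc0.locallyIntegrableOn_Ioo, IntegrableOn.locallyIntegrableOn hi, fun φ hφ => ?_⟩,
    primitive_zero _, ?_, primitive_zero _, ?_⟩
  · rw [iteratedDeriv_one, hw1 φ hφ]
    ring
  · rw [iteratedDeriv_succ, iteratedDeriv_one, hw1 _ hφ.deriv, hw2 φ hφ]
    ring
  · rw [primitive_one, hint]
  · rw [primitive_one, h0]

/-- A function that is continuous on `[0,1]`, vanishes at `0` and has the weak derivative `g` is the
primitive of `g`. -/
theorem eqOn_primitive_of_weakDeriv {f g : ℝ → ℝ} (hf : ContinuousOn f (Icc 0 1)) (hf0 : f 0 = 0)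
    (hg : Integrable g unitMeasure)
    (h : ∀ φ, IsTestFunction φ → ∫ x, f x * deriv φ x ∂unitMeasure =
      -∫ x, g x * φ x ∂unitMeasure) : EqOn f (primitive g) (Icc 0 1) := by
  have hc := continuousOn_primitive hg
  obtain ⟨c, hcc⟩ := ae_eq_const_of_forall_integral_mul_deriv (f := fun x => f x - primitive g x)
    (hf.sub hc).locallyIntegrableOn_Ioo fun φ hφ => by
      have e1 : Integrable (fun x => f x * deriv φ x) unitMeasure :=
        integrable_of_continuousOn (hf.mul hφ.deriv.1.continuous.continuousOn)
      have e2 : Integrable (fun x => primitive g x * deriv φ x) unitMeasure :=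
        integrable_of_continuousOn (hc.mul hφ.deriv.1.continuous.continuousOn)
      simp only [sub_mul]
      rw [integral_sub e1 e2, h φ hφ, integral_primitive_mul_deriv hg hφ.contDiff_one,
        hφ.eq_zero (x := 1) (by simp)]
      ring
  have hIcc : (fun x => f x - primitive g x) =ᵐ[volume.restrict (Icc 0 1)] fun _ => c := by
    rwa [← restrict_Ioo_eq_restrict_Icc]
  have heq : EqOn (fun x => f x - primitive g x) (fun _ => c) (Icc 0 1) :=
    Measure.eqOn_Icc_of_ae_eq volume zero_ne_one hIcc (hf.sub hc) continuousOn_const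
  have h0 := heq (left_mem_Icc.2 zero_le_one)
  simp only [hf0, primitive_zero, sub_zero] at h0
  intro x hx
  have hx' := heq hx
  simp only [← h0] at hx'
  exact sub_eq_zero.1 hx'

theorem IsH20.eqOn_primitive_deriv {f f₁ f₂ : ℝ → ℝ} (h : IsH20 f f₁ f₂) :
    EqOn f₁ (primitive f₂) (Icc 0 1) := by
  refine eqOn_primitive_of_weakDeriv h.continuousOn_deriv h.deriv_left
    (MemLp.integrable_unitMeasure h.memLp) fun φ hφ => ?_
  have h1 := h.weakDeriv_one.2.2 _ hφ.deriv
  have h2 := h.weakDeriv_two.2.2 _ hφ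
  rw [iteratedDeriv_succ, iteratedDeriv_one] at h2
  rw [iteratedDeriv_one] at h1
  linarith

theorem IsH20.eqOn_primitive {f f₁ f₂ : ℝ → ℝ} (h : IsH20 f f₁ f₂) :
    EqOn f (primitive (primitive f₂)) (Icc 0 1) := by
  have h1 : EqOn f (primitive f₁) (Icc 0 1) := by
    refine eqOn_primitive_of_weakDeriv h.continuousOn h.left
      (integrable_of_continuousOn h.continuousOn_deriv) fun φ hφ => ?_
    have h1 := h.weakDeriv_one.2.2 _ hφ
    rw [iteratedDeriv_one] at h1
    linarith
  intro x hx
  rw [h1 hx]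
  refine primitive_congr ?_ hx
  exact (ae_restrict_iff' measurableSet_Ioo).2
    (Filter.Eventually.of_forall fun y hy => h.eqOn_primitive_deriv (Ioo_subset_Icc_self hy))

theorem IsH20.integral_eq_zero {f f₁ f₂ : ℝ → ℝ} (h : IsH20 f f₁ f₂) :
    ∫ x, f₂ x ∂unitMeasure = 0 := by
  rw [← primitive_one, ← h.eqOn_primitive_deriv (right_mem_Icc.2 zero_le_one), h.deriv_right]

theorem IsH20.integral_mul_id_eq_zero {f f₁ f₂ : ℝ → ℝ} (h : IsH20 f f₁ f₂) :
    ∫ x, f₂ x * x ∂unitMeasure = 0 := by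
  have h1 := h.eqOn_primitive (right_mem_Icc.2 zero_le_one)
  rw [h.right, primitive_one, integral_primitive (MemLp.integrable_unitMeasure h.memLp),
    h.integral_eq_zero] at h1
  linarith

end ClampedSobolev

/-! ### The weight `1 / a` -/

section Weight

variable {a : ℝ → ℝ}

theorem ae_unitMeasure {p : ℝ → Prop} (h : ∀ x ∈ Ioo (0 : ℝ) 1, p x) : ∀ᵐ x ∂unitMeasure, p x :=
  (ae_restrict_iff' measurableSet_Ioo).2 (Filter.Eventually.of_forall h)

instance : IsProbabilityMeasure unitMeasure := ⟨by simp⟩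

theorem DegenerateCoefficient.pos_of_mem_Ioo (ha : DegenerateCoefficient a) {x : ℝ}
    (hx : x ∈ Ioo (0 : ℝ) 1) : 0 < a x :=
  ha.pos x ⟨hx.1, hx.2.le⟩

/-- The weight satisfies `1 / a ≤ C / x²`: near `0` because `x ^ K / a` is bounded there and
`K < 2`, elsewhere by compactness. -/
theorem DegenerateCoefficient.exists_sq_div_le (ha : DegenerateCoefficient a) :
    ∃ C : ℝ, ∀ x ∈ Ioo (0 : ℝ) 1, x ^ 2 / a x ≤ C := by
  obtain ⟨K, hK, δ, hδ, hmono⟩ := ha.monotone_near_zero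
  have hδ2 : δ / 2 ∈ Ioo (0 : ℝ) δ := ⟨half_pos hδ.1, half_lt_self hδ.1⟩
  have hpos : ∀ x ∈ Icc (δ / 2) 1, 0 < a x := fun x hx => ha.pos x ⟨hδ2.1.trans_le hx.1, hx.2⟩
  have hcont : ContinuousOn (fun x => x ^ 2 / a x) (Icc (δ / 2) 1) :=
    (continuous_pow 2).continuousOn.div
      (ha.continuousOn.mono (Icc_subset_Icc_left hδ2.1.le)) fun x hx => (hpos x hx).ne'
  obtain ⟨C, hC⟩ := isCompact_Icc.bddAbove_image hcont
  refine ⟨max C ((δ / 2) ^ K / a (δ / 2)), fun x hx => ?_⟩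
  rcases le_or_gt (δ / 2) x with h | h
  · exact le_max_of_le_left (hC ⟨x, ⟨h, hx.2.le⟩, rfl⟩)
  · refine le_max_of_le_right ?_
    refine le_trans ?_ (hmono ⟨hx.1, h.trans hδ2.2⟩ hδ2 h.le)
    have hax := ha.pos_of_mem_Ioo hx
    have hpow : x ^ 2 ≤ x ^ K := by
      rw [← Real.rpow_two]
      exact Real.rpow_le_rpow_of_exponent_ge hx.1 hx.2.le hK.2.le
    simp only
    gcongr

theorem DegenerateCoefficient.aemeasurable (ha : DegenerateCoefficient a) :
    AEMeasurable a unitMeasure :=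
  (ha.continuousOn.mono Ioo_subset_Icc_self).aemeasurable measurableSet_Ioo

theorem DegenerateCoefficient.aemeasurable_density (ha : DegenerateCoefficient a) :
    AEMeasurable (fun x => ENNReal.ofReal (1 / a x)) unitMeasure :=
  (ha.aemeasurable.const_div 1).ennreal_ofReal

theorem DegenerateCoefficient.toReal_density (ha : DegenerateCoefficient a) :
    ∀ᵐ x ∂unitMeasure, (ENNReal.ofReal (1 / a x)).toReal = (a x)⁻¹ :=
  ae_unitMeasure fun x hx => by
    rw [ENNReal.toReal_ofReal (one_div_pos.2 (ha.pos_of_mem_Ioo hx)).le, one_div]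

theorem weightMeasure_absolutelyContinuous : weightMeasure a ≪ unitMeasure :=
  withDensity_absolutelyContinuous _ _

theorem DegenerateCoefficient.absolutelyContinuous_weightMeasure (ha : DegenerateCoefficient a) :
    unitMeasure ≪ weightMeasure a :=
  withDensity_absolutelyContinuous' ha.aemeasurable_density <| ae_unitMeasure fun x hx => by
    simpa using ha.pos_of_mem_Ioo hx

theorem DegenerateCoefficient.integral_weightMeasure (ha : DegenerateCoefficient a) (f : ℝ → ℝ) :
    ∫ x, f x ∂weightMeasure a = ∫ x, f x / a x ∂unitMeasure := by
  rw [weightMeasure, integral_withDensity_eq_integral_toReal_smul₀ ha.aemeasurable_density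
    (Filter.Eventually.of_forall fun x => ENNReal.ofReal_lt_top)]
  refine integral_congr_ae ?_
  filter_upwards [ha.toReal_density] with x hx
  rw [hx, smul_eq_mul, div_eq_inv_mul]

theorem DegenerateCoefficient.integrable_weightMeasure_iff (ha : DegenerateCoefficient a)
    {f : ℝ → ℝ} :
    Integrable f (weightMeasure a) ↔ Integrable (fun x => f x / a x) unitMeasure := by
  rw [weightMeasure, integrable_withDensity_iff_integrable_smul₀' ha.aemeasurable_density
    (Filter.Eventually.of_forall fun x => ENNReal.ofReal_lt_top)]
  refine integrable_congr ?_
  filter_upwards [ha.toReal_density] with x hx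
  rw [hx, smul_eq_mul, div_eq_inv_mul]

theorem DegenerateCoefficient.memLp_id (ha : DegenerateCoefficient a) :
    MemLp (fun x : ℝ => x) 2 (weightMeasure a) := by
  rw [memLp_two_iff_integrable_sq (f := fun x : ℝ => x) measurable_id.aestronglyMeasurable,
    ha.integrable_weightMeasure_iff]
  obtain ⟨C, hC⟩ := ha.exists_sq_div_le
  refine Integrable.of_bound
    ((measurable_id.pow_const 2).aemeasurable.div ha.aemeasurable).aestronglyMeasurable C
    (ae_unitMeasure fun x hx => ?_)
  rw [Real.norm_of_nonneg (div_nonneg (sq_nonneg x) (ha.pos_of_mem_Ioo hx).le)]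
  exact hC x hx

theorem DegenerateCoefficient.memLp_coefficient (ha : DegenerateCoefficient a) :
    MemLp a 2 (weightMeasure a) := by
  rw [memLp_two_iff_integrable_sq
    (ha.aemeasurable.mono_ac weightMeasure_absolutelyContinuous).aestronglyMeasurable,
    ha.integrable_weightMeasure_iff]
  refine (integrable_of_continuousOn ha.continuousOn).congr (ae_unitMeasure fun x hx => ?_)
  have := (ha.pos_of_mem_Ioo hx).ne'
  field_simp

/-- `h = (h a) / a`, and `h`, `a` both belong to `L²_{1/a}`. -/
theorem DegenerateCoefficient.integrable_of_memLp (ha : DegenerateCoefficient a) {h : ℝ → ℝ}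
    (hh : MemLp h 2 (weightMeasure a)) : Integrable h unitMeasure := by
  refine (ha.integrable_weightMeasure_iff.1 (hh.integrable_mul ha.memLp_coefficient)).congr
    (ae_unitMeasure fun x hx => ?_)
  have := (ha.pos_of_mem_Ioo hx).ne'
  simp only [Pi.mul_apply]
  field_simp

theorem DegenerateCoefficient.locallyIntegrableOn_div (ha : DegenerateCoefficient a) {h : ℝ → ℝ}
    (hh : MemLp h 2 (weightMeasure a)) : LocallyIntegrableOn (fun x => h x / a x) (Ioo 0 1) := by
  have h1 : LocallyIntegrableOn h (Ioo 0 1) :=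
    IntegrableOn.locallyIntegrableOn (ha.integrable_of_memLp hh)
  have h2 : ContinuousOn (fun x => (a x)⁻¹) (Ioo 0 1) :=
    (ha.continuousOn.mono Ioo_subset_Icc_self).inv₀ fun x hx => (ha.pos_of_mem_Ioo hx).ne'
  simpa only [div_eq_mul_inv] using h1.mul_continuousOn h2 isOpen_Ioo.isLocallyClosed

end Weight

/-! ### Primitives as bounded operators -/

section PrimitiveOperators

theorem integral_abs_le_norm (g : L2) : ∫ s, |g s| ∂unitMeasure ≤ ‖g‖ := by
  have h := eLpNorm_le_eLpNorm_of_exponent_le (μ := unitMeasure) (p := 1) (q := 2)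
    (by norm_num) (Lp.aestronglyMeasurable g)
  have h2 := ENNReal.toReal_mono (Lp.eLpNorm_ne_top g) h
  rw [← Lp.norm_def, eLpNorm_one_eq_lintegral_enorm,
    ← integral_norm_eq_lintegral_enorm (Lp.aestronglyMeasurable g)] at h2
  exact h2

theorem integrable_L2 (g : L2) : Integrable g unitMeasure :=
  MemLp.integrable_unitMeasure (Lp.memLp g)

theorem abs_primitive_le_norm (g : L2) {x : ℝ} (hx : x ∈ Icc (0 : ℝ) 1) :
    |primitive g x| ≤ ‖g‖ :=
  (abs_primitive_le_integral (integrable_L2 g) hx).trans (integral_abs_le_norm g)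

theorem abs_primitive_primitive_le_norm (g : L2) {x : ℝ} (hx : x ∈ Icc (0 : ℝ) 1) :
    |primitive (primitive g) x| ≤ ‖g‖ * x :=
  abs_primitive_le (fun _ hs => abs_primitive_le_norm g hs) hx

theorem primitive_add {f g : ℝ → ℝ} (hf : Integrable f unitMeasure) (hg : Integrable g unitMeasure)
    {x : ℝ} (hx : x ∈ Icc (0 : ℝ) 1) :
    primitive (fun s => f s + g s) x = primitive f x + primitive g x := by
  have hsub : uIcc (0 : ℝ) x ⊆ uIcc 0 1 := by
    rw [uIcc_of_le hx.1, uIcc_of_le zero_le_one]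
    exact Icc_subset_Icc_right hx.2
  exact intervalIntegral.integral_add ((intervalIntegrable_of_unitMeasure hf).mono_set hsub)
    ((intervalIntegrable_of_unitMeasure hg).mono_set hsub)

theorem primitive_const_mul (c : ℝ) (f : ℝ → ℝ) (x : ℝ) :
    primitive (fun s => c * f s) x = c * primitive f x :=
  intervalIntegral.integral_const_mul c f

theorem primitive_coeFn_add (f g : L2) {x : ℝ} (hx : x ∈ Icc (0 : ℝ) 1) :
    primitive (f + g : L2) x = primitive f x + primitive g x := by
  rw [primitive_congr (Lp.coeFn_add f g) hx]
  exact primitive_add (integrable_L2 f) (integrable_L2 g) hx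

theorem primitive_coeFn_smul (c : ℝ) (f : L2) {x : ℝ} (hx : x ∈ Icc (0 : ℝ) 1) :
    primitive (c • f : L2) x = c * primitive f x := by
  rw [primitive_congr (Lp.coeFn_smul c f) hx]
  exact primitive_const_mul c f x

theorem primitive_primitive_coeFn_add (f g : L2) {x : ℝ} (hx : x ∈ Icc (0 : ℝ) 1) :
    primitive (primitive (f + g : L2)) x =
      primitive (primitive f) x + primitive (primitive g) x := by
  rw [primitive_congr (g := fun s => primitive f s + primitive g s)
    (ae_unitMeasure fun s hs => primitive_coeFn_add f g (Ioo_subset_Icc_self hs)) hx]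
  exact primitive_add (integrable_primitive (integrable_L2 f))
    (integrable_primitive (integrable_L2 g)) hx

theorem primitive_primitive_coeFn_smul (c : ℝ) (f : L2) {x : ℝ} (hx : x ∈ Icc (0 : ℝ) 1) :
    primitive (primitive (c • f : L2)) x = c * primitive (primitive f) x := by
  rw [primitive_congr (g := fun s => c * primitive f s)
    (ae_unitMeasure fun s hs => primitive_coeFn_smul c f (Ioo_subset_Icc_self hs)) hx]
  exact primitive_const_mul c _ x

theorem aestronglyMeasurable_of_continuousOn {f : ℝ → ℝ} (hf : ContinuousOn f (Icc 0 1)) :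
    AEStronglyMeasurable f unitMeasure :=
  (integrable_of_continuousOn hf).aestronglyMeasurable

theorem memLp_primitive (g : L2) : MemLp (primitive g) 2 unitMeasure :=
  MemLp.of_bound (aestronglyMeasurable_of_continuousOn (continuousOn_primitive (integrable_L2 g)))
    ‖g‖ (ae_unitMeasure fun _ hx => abs_primitive_le_norm g (Ioo_subset_Icc_self hx))

/-- The operator `g ↦ ∫₀ˣ g` on `L²(0,1)`. -/
noncomputable def primitiveL : L2 →L[ℝ] L2 :=
  LinearMap.mkContinuous
    { toFun := fun g => (memLp_primitive g).toLp
      map_add' := fun f g => by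
        rw [← MemLp.toLp_add]
        exact MemLp.toLp_congr _ _ (ae_unitMeasure fun x hx =>
          primitive_coeFn_add f g (Ioo_subset_Icc_self hx))
      map_smul' := fun c f => by
        rw [RingHom.id_apply, ← MemLp.toLp_const_smul]
        exact MemLp.toLp_congr _ _ (ae_unitMeasure fun x hx =>
          primitive_coeFn_smul c f (Ioo_subset_Icc_self hx)) }
    1 fun g => by
      have h := Lp.norm_le_of_ae_bound (f := (memLp_primitive g).toLp) (norm_nonneg g) (by
        filter_upwards [(memLp_primitive g).coeFn_toLp,
          ae_unitMeasure fun x hx => abs_primitive_le_norm g (Ioo_subset_Icc_self hx)] with x h1 h2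
        rwa [h1])
      simpa [measureUnivNNReal] using h

theorem primitiveL_ae (g : L2) : primitiveL g =ᵐ[unitMeasure] primitive g :=
  (memLp_primitive g).coeFn_toLp

variable {a : ℝ → ℝ}

theorem DegenerateCoefficient.memLp_primitive_primitive (ha : DegenerateCoefficient a) (g : L2) :
    MemLp (primitive (primitive g)) 2 (weightMeasure a) := by
  refine ha.memLp_id.of_le_mul (c := ‖g‖)
    ((aestronglyMeasurable_of_continuousOn (continuousOn_primitive
      (integrable_primitive (integrable_L2 g)))).mono_ac weightMeasure_absolutelyContinuous)
    (weightMeasure_absolutelyContinuous.ae_le (ae_unitMeasure fun x hx => ?_))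
  simpa [abs_of_pos hx.1] using abs_primitive_primitive_le_norm g (Ioo_subset_Icc_self hx)

/-- The operator `g ↦ ∫₀ˣ ∫₀ˢ g` from `L²(0,1)` to `L²_{1/a}(0,1)`. It is bounded because
`|∫₀ˣ ∫₀ˢ g| ≤ x ‖g‖` and `x ∈ L²_{1/a}`. -/
noncomputable def DegenerateCoefficient.doublePrimitiveL (ha : DegenerateCoefficient a) :
    L2 →L[ℝ] L2w a :=
  LinearMap.mkContinuous
    { toFun := fun g => (ha.memLp_primitive_primitive g).toLp
      map_add' := fun f g => by
        rw [← MemLp.toLp_add]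
        exact MemLp.toLp_congr _ _ (weightMeasure_absolutelyContinuous.ae_le
          (ae_unitMeasure fun x hx => primitive_primitive_coeFn_add f g (Ioo_subset_Icc_self hx)))
      map_smul' := fun c f => by
        rw [RingHom.id_apply, ← MemLp.toLp_const_smul]
        exact MemLp.toLp_congr _ _ (weightMeasure_absolutelyContinuous.ae_le
          (ae_unitMeasure fun x hx => primitive_primitive_coeFn_smul c f
            (Ioo_subset_Icc_self hx))) }
    ‖ha.memLp_id.toLp‖ fun g => by
      rw [mul_comm]
      refine Lp.norm_le_mul_norm_of_ae_le_mul (weightMeasure_absolutelyContinuous.ae_le ?_)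
      filter_upwards [ha.absolutelyContinuous_weightMeasure.ae_le
        (ha.memLp_primitive_primitive g).coeFn_toLp,
        ha.absolutelyContinuous_weightMeasure.ae_le ha.memLp_id.coeFn_toLp,
        ae_unitMeasure fun x hx => abs_primitive_primitive_le_norm g (Ioo_subset_Icc_self hx),
        ae_unitMeasure fun x hx => hx.1] with x h1 h2 h3 h4
      change ‖(ha.memLp_primitive_primitive g).toLp _ x‖ ≤ _
      rwa [h1, h2, Real.norm_eq_abs, Real.norm_of_nonneg h4.le]

theorem DegenerateCoefficient.doublePrimitiveL_ae (ha : DegenerateCoefficient a) (g : L2) :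
    ha.doublePrimitiveL g =ᵐ[weightMeasure a] primitive (primitive g) :=
  (ha.memLp_primitive_primitive g).coeFn_toLp

end PrimitiveOperators

/-! ### The space of second derivatives and the operator `A` -/

section Curvature

/-- The constant function `1` in `L²(0,1)`. -/
noncomputable def oneL2 : L2 := (memLp_const (μ := unitMeasure) (p := 2) (1 : ℝ)).toLp

theorem memLp_id_unitMeasure : MemLp (fun x : ℝ => x) 2 unitMeasure :=
  MemLp.of_bound measurable_id.aestronglyMeasurable 1 (ae_unitMeasure fun x hx => by
    rw [Real.norm_of_nonneg hx.1.le]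
    exact hx.2.le)

/-- The function `x` in `L²(0,1)`. -/
noncomputable def idL2 : L2 := memLp_id_unitMeasure.toLp

/-- The orthogonal complement of the affine functions in `L²(0,1)`: the space of second derivatives
of elements of `H²₀(0,1)`. -/
noncomputable abbrev Curvature : Submodule ℝ L2 := (Submodule.span ℝ {oneL2, idL2})ᗮ

theorem mem_curvature_iff {g : L2} : g ∈ Curvature ↔
    ∫ x, g x ∂unitMeasure = 0 ∧ ∫ x, g x * x ∂unitMeasure = 0 := by
  have h1 : inner ℝ oneL2 g = ∫ x, g x ∂unitMeasure := by
    rw [L2.inner_def]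
    refine integral_congr_ae ?_
    filter_upwards [(memLp_const (μ := unitMeasure) (p := 2) (1 : ℝ)).coeFn_toLp] with x hx
    rw [oneL2, hx]
    simp
  have h2 : inner ℝ idL2 g = ∫ x, g x * x ∂unitMeasure := by
    rw [L2.inner_def]
    refine integral_congr_ae ?_
    filter_upwards [memLp_id_unitMeasure.coeFn_toLp] with x hx
    rw [idL2, hx]
    simp
  rw [← h1, ← h2, Submodule.mem_orthogonal]
  constructor
  · exact fun h => ⟨h _ (Submodule.subset_span (by simp)), h _ (Submodule.subset_span (by simp))⟩
  · rintro ⟨h1, h2⟩ u hu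
    obtain ⟨c, d, rfl⟩ := Submodule.mem_span_pair.1 hu
    simp [inner_add_left, real_inner_smul_left, h1, h2]

theorem isH20_of_curvature (g : Curvature) :
    IsH20 (primitive (primitive (g : L2))) (primitive (g : L2)) (g : L2) :=
  IsH20.of_moments (Lp.memLp _) (mem_curvature_iff.1 g.2).1 (mem_curvature_iff.1 g.2).2

variable {a : ℝ → ℝ}

theorem H2w.curvature_mem (u : H2w a) : u.1.snd.snd ∈ Curvature := by
  obtain ⟨f, f₁, f₂, h, -, -, h2⟩ := u.2
  refine mem_curvature_iff.2 ⟨?_, ?_⟩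
  · rw [integral_congr_ae h2, h.integral_eq_zero]
  · rw [← h.integral_mul_id_eq_zero]
    refine integral_congr_ae ?_
    filter_upwards [h2] with x hx
    rw [hx]

theorem H2w.snd_fst_eq (u : H2w a) : u.1.snd.fst = primitiveL u.1.snd.snd := by
  obtain ⟨f, f₁, f₂, h, -, h1, h2⟩ := u.2
  refine Lp.ext ?_
  filter_upwards [h1, primitiveL_ae u.1.snd.snd, ae_unitMeasure fun x hx => hx] with x e1 e2 hx
  rw [e1, e2, h.eqOn_primitive_deriv (Ioo_subset_Icc_self hx),
    primitive_congr h2 (Ioo_subset_Icc_self hx)]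

theorem H2w.fst_eq (ha : DegenerateCoefficient a) (u : H2w a) :
    u.1.fst = ha.doublePrimitiveL u.1.snd.snd := by
  obtain ⟨f, f₁, f₂, h, h0, -, h2⟩ := u.2
  refine Lp.ext ?_
  filter_upwards [h0, ha.doublePrimitiveL_ae u.1.snd.snd,
    weightMeasure_absolutelyContinuous.ae_le (ae_unitMeasure fun x hx => hx)] with x e1 e2 hx
  rw [e1, e2, h.eqOn_primitive (Ioo_subset_Icc_self hx)]
  refine (primitive_congr (ae_unitMeasure fun s hs => ?_) (Ioo_subset_Icc_self hx)).symm
  exact primitive_congr h2 (Ioo_subset_Icc_self hs)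

/-- The second derivative `H²_{1/a} → Curvature`. -/
noncomputable def H2w.curvatureL (a : ℝ → ℝ) : H2w a →L[ℝ] Curvature :=
  ((WithLp.sndL 2 ℝ L2 L2 ∘L WithLp.sndL 2 ℝ (L2w a) (WithLp 2 (L2 × L2))) ∘L
    (H2w a).subtypeL).codRestrict Curvature H2w.curvature_mem

/-- The triple `(∫∫ g, ∫ g, g)`. -/
noncomputable def DegenerateCoefficient.tripleL (ha : DegenerateCoefficient a) :
    L2 →L[ℝ] WithLp 2 (L2w a × WithLp 2 (L2 × L2)) :=
  (WithLp.prodContinuousLinearEquiv 2 ℝ (L2w a) (WithLp 2 (L2 × L2))).symm.toContinuousLinearMap ∘L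
    (ha.doublePrimitiveL.prod
      ((WithLp.prodContinuousLinearEquiv 2 ℝ L2 L2).symm.toContinuousLinearMap ∘L
        (primitiveL.prod (ContinuousLinearMap.id ℝ L2))))

theorem DegenerateCoefficient.tripleL_apply (ha : DegenerateCoefficient a) (g : L2) :
    ha.tripleL g = WithLp.toLp 2 (ha.doublePrimitiveL g, WithLp.toLp 2 (primitiveL g, g)) := rfl

theorem DegenerateCoefficient.tripleL_mem (ha : DegenerateCoefficient a) (g : Curvature) :
    ha.tripleL g ∈ H2w a := by
  rw [ha.tripleL_apply]
  exact ⟨_, _, _, isH20_of_curvature g, ha.doublePrimitiveL_ae _, primitiveL_ae _,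
    Filter.EventuallyEq.rfl⟩

theorem DegenerateCoefficient.tripleL_eq (ha : DegenerateCoefficient a) (u : H2w a) :
    ha.tripleL u.1.snd.snd = u.1 := by
  rw [ha.tripleL_apply, ← H2w.snd_fst_eq, ← H2w.fst_eq]
  rfl

/-- The second derivative identifies `H²_{1/a}` with `Curvature`. In particular `‖u''‖` is an
equivalent norm on `H²_{1/a}`. -/
noncomputable def DegenerateCoefficient.curvatureEquiv (ha : DegenerateCoefficient a) :
    H2w a ≃L[ℝ] Curvature :=
  ContinuousLinearEquiv.equivOfInverse (H2w.curvatureL a)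
    ((ha.tripleL ∘L Curvature.subtypeL).codRestrict (H2w a) ha.tripleL_mem)
    (fun u => Subtype.ext (ha.tripleL_eq u)) (fun _ => Subtype.ext rfl)

/-- The inclusion `H²_{1/a} ⊆ L²_{1/a}`, as a map of the second derivative. -/
noncomputable def DegenerateCoefficient.embedding (ha : DegenerateCoefficient a) :
    Curvature →L[ℝ] L2w a :=
  ha.doublePrimitiveL ∘L Curvature.subtypeL

theorem DegenerateCoefficient.embedding_curvatureEquiv (ha : DegenerateCoefficient a) (u : H2w a) :
    ha.embedding (ha.curvatureEquiv u) = H2w.incl u :=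
  (H2w.fst_eq ha u).symm

theorem DegenerateCoefficient.incl_curvatureEquiv_symm (ha : DegenerateCoefficient a)
    (g : Curvature) : H2w.incl (ha.curvatureEquiv.symm g) = ha.embedding g := by
  rw [← ha.embedding_curvatureEquiv, ContinuousLinearEquiv.apply_symm_apply]

theorem DegenerateCoefficient.embedding_ae (ha : DegenerateCoefficient a) (g : Curvature) :
    ha.embedding g =ᵐ[weightMeasure a] primitive (primitive (g : L2)) :=
  ha.doublePrimitiveL_ae _

theorem DegenerateCoefficient.embedding_eq_zero (ha : DegenerateCoefficient a) {g : Curvature}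
    (hg : ha.embedding g = 0) : g = 0 := by
  have h0 : primitive (primitive (g : L2)) =ᵐ[unitMeasure] 0 := by
    refine ha.absolutelyContinuous_weightMeasure.ae_le ?_
    filter_upwards [ha.embedding_ae g, Lp.coeFn_zero ℝ 2 (weightMeasure a)] with x h1 h2
    rw [← h1, hg, h2]
  refine Subtype.ext (Lp.ext ?_)
  refine (ae_eq_zero_of_forall_isTestFunction
    (IntegrableOn.locallyIntegrableOn (integrable_L2 g)) fun φ hφ => ?_).trans
    (Lp.coeFn_zero ℝ 2 unitMeasure).symm
  have h := (isH20_of_curvature g).weakDeriv_two.2.2 φ hφ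
  rw [neg_one_sq, one_mul] at h
  rw [← h]
  refine integral_eq_zero_of_ae ?_
  filter_upwards [h0] with x hx
  simp [hx]

theorem IsTestFunction.memLp {φ : ℝ → ℝ} (hφ : IsTestFunction φ) : MemLp φ 2 unitMeasure := by
  obtain ⟨C, hC⟩ := hφ.1.continuous.bounded_above_of_compact_support hφ.2.1
  exact MemLp.of_bound hφ.1.continuous.aestronglyMeasurable C (Filter.Eventually.of_forall hC)

/-- The second derivative of a test function, as an element of `Curvature`. -/
noncomputable def IsTestFunction.curvature {φ : ℝ → ℝ} (hφ : IsTestFunction φ) : Curvature :=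
  ⟨hφ.deriv.deriv.memLp.toLp, mem_curvature_iff.2 (by
    have h := hφ.deriv.deriv.memLp.coeFn_toLp
    constructor
    · rw [integral_congr_ae h, hφ.deriv.integral_deriv]
    · have h1 := integral_primitive hφ.deriv.deriv.integrable
      rw [hφ.deriv.primitive_deriv, hφ.deriv.integral_deriv, hφ.integral_deriv] at h1
      have h2 : ∫ x, hφ.deriv.deriv.memLp.toLp _ x * x ∂unitMeasure =
          ∫ x, _root_.deriv (_root_.deriv φ) x * x ∂unitMeasure := by
        refine integral_congr_ae ?_
        filter_upwards [h] with x hx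
        rw [hx]
      rw [h2]
      linarith)⟩

theorem IsTestFunction.curvature_ae {φ : ℝ → ℝ} (hφ : IsTestFunction φ) :
    (hφ.curvature : L2) =ᵐ[unitMeasure] _root_.deriv (_root_.deriv φ) :=
  hφ.deriv.deriv.memLp.coeFn_toLp

theorem IsTestFunction.inner_curvature {φ : ℝ → ℝ} (hφ : IsTestFunction φ) (g : Curvature) :
    inner ℝ hφ.curvature g = ∫ x, (g : L2) x * _root_.deriv (_root_.deriv φ) x ∂unitMeasure := by
  rw [Submodule.coe_inner, L2.inner_def]
  refine integral_congr_ae ?_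
  filter_upwards [hφ.curvature_ae] with x hx
  rw [hx]
  rfl

theorem IsTestFunction.embedding_curvature_ae {φ : ℝ → ℝ} (hφ : IsTestFunction φ)
    (ha : DegenerateCoefficient a) : ha.embedding hφ.curvature =ᵐ[weightMeasure a] φ := by
  filter_upwards [ha.embedding_ae hφ.curvature,
    weightMeasure_absolutelyContinuous.ae_le (ae_unitMeasure fun x hx => hx)] with x h1 hx
  have hx' := Ioo_subset_Icc_self hx
  rw [h1, primitive_congr (g := _root_.deriv φ) (ae_unitMeasure fun s hs => ?_) hx', hφ.primitive_deriv]
  rw [primitive_congr hφ.curvature_ae (Ioo_subset_Icc_self hs), hφ.deriv.primitive_deriv]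

theorem IsTestFunction.inner_embedding {φ : ℝ → ℝ} (hφ : IsTestFunction φ)
    (ha : DegenerateCoefficient a) (h : L2w a) :
    inner ℝ (ha.embedding hφ.curvature) h = ∫ x, h x / a x * φ x ∂unitMeasure := by
  rw [L2.inner_def, ← show ∫ x, h x * φ x ∂weightMeasure a = ∫ x, h x / a x * φ x ∂unitMeasure by
    rw [ha.integral_weightMeasure]
    simp only [div_mul_eq_mul_div]]
  refine integral_congr_ae ?_
  filter_upwards [hφ.embedding_curvature_ae ha] with x hx
  rw [hx]
  rfl

/-- Test functions are dense in `H²₀`: a function orthogonal to their second derivatives is affine,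
hence orthogonal to itself if it lies in `Curvature`. -/
theorem curvature_eq_zero_of_forall_inner {g : Curvature}
    (h : ∀ φ (hφ : IsTestFunction φ), inner ℝ hφ.curvature g = 0) : g = 0 := by
  obtain ⟨c, d, hcd⟩ := ae_eq_affine_of_forall_integral_mul_deriv_deriv
    (IntegrableOn.locallyIntegrableOn (integrable_L2 g)) fun φ hφ => by
      rw [← hφ.inner_curvature, h]
  obtain ⟨h0, h1⟩ := mem_curvature_iff.1 g.2
  have hi : Integrable (fun x => (g : L2) x * x) unitMeasure :=
    (Lp.memLp (g : L2)).integrable_mul memLp_id_unitMeasure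
  refine inner_self_eq_zero (𝕜 := ℝ).1 ?_
  rw [Submodule.coe_inner, L2.inner_def]
  calc ∫ x, inner ℝ ((g : L2) x) ((g : L2) x) ∂unitMeasure
      = ∫ x, (c * (g : L2) x + d * ((g : L2) x * x)) ∂unitMeasure := by
        refine integral_congr_ae ?_
        filter_upwards [hcd] with x hx
        change (g : L2) x * (g : L2) x = _
        rw [hx]
        ring
    _ = 0 := by
        rw [integral_add ((integrable_L2 g).const_mul c) (hi.const_mul d), integral_const_mul,
          integral_const_mul, h0, h1, mul_zero, mul_zero, add_zero]

/-- The inclusion `H²_{1/a} ⊆ L²_{1/a}` has dense range, in dual form. -/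
theorem DegenerateCoefficient.adjoint_embedding_eq_zero (ha : DegenerateCoefficient a) {h : L2w a}
    (hh : ContinuousLinearMap.adjoint ha.embedding h = 0) : h = 0 := by
  have hz := ae_eq_zero_of_forall_isTestFunction (ha.locallyIntegrableOn_div (Lp.memLp h))
    fun φ hφ => by
      rw [← hφ.inner_embedding ha, ← ContinuousLinearMap.adjoint_inner_right, hh, inner_zero_right]
  refine Lp.ext ?_
  filter_upwards [weightMeasure_absolutelyContinuous.ae_le hz, Lp.coeFn_zero ℝ 2 (weightMeasure a),
    weightMeasure_absolutelyContinuous.ae_le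
      (ae_unitMeasure fun x hx => (ha.pos_of_mem_Ioo hx).ne')] with x h1 h2 h3
  rw [h2]
  simpa [h3] using h1

/-- `A` is the operator of the form `∫ u'' v''` on `L²_{1/a}`: with `ι` the inclusion of `H²_{1/a}`
in terms of second derivatives, its inverse is `ι ι†`. The implication from left to right is the
Gauss–Green formula `∫ u'''' v = ∫ u'' v''`, obtained from test functions `v` by density. -/
theorem DegenerateCoefficient.mem_domA_iff (ha : DegenerateCoefficient a)
    {p : WithLp 2 (L2w a × L2w a)} :
    p ∈ DomA a ↔ p.fst = ha.embedding (ContinuousLinearMap.adjoint ha.embedding p.snd) := by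
  constructor
  · rintro ⟨⟨u, hu⟩, f, g, hfg, hf, hg⟩
    rw [← hu, ← ha.embedding_curvatureEquiv]
    congr 1
    refine sub_eq_zero.1 (curvature_eq_zero_of_forall_inner fun φ hφ => ?_)
    rw [inner_sub_right, ContinuousLinearMap.adjoint_inner_right, hφ.inner_curvature,
      hφ.inner_embedding ha, sub_eq_zero]
    have hrep : f =ᵐ[unitMeasure] primitive (primitive (ha.curvatureEquiv u : L2)) := by
      refine ha.absolutelyContinuous_weightMeasure.ae_le ?_
      filter_upwards [hf, ha.embedding_ae (ha.curvatureEquiv u)] with x h1 h2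
      rw [← h1, ← h2, ha.embedding_curvatureEquiv, hu]
    have h2 := (isH20_of_curvature (ha.curvatureEquiv u)).weakDeriv_two.2.2 _ hφ.deriv.deriv
    have h4 := hfg.2.2 φ hφ
    rw [show iteratedDeriv 4 φ = iteratedDeriv 2 (deriv (deriv φ)) by
      rw [iteratedDeriv_succ', iteratedDeriv_succ']] at h4
    have h5 : ∫ x, f x * iteratedDeriv 2 (deriv (deriv φ)) x ∂unitMeasure =
        ∫ x, primitive (primitive (ha.curvatureEquiv u : L2)) x *
          iteratedDeriv 2 (deriv (deriv φ)) x ∂unitMeasure := by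
      refine integral_congr_ae ?_
      filter_upwards [hrep] with x hx
      rw [hx]
    have h6 : ∫ x, p.snd x / a x * φ x ∂unitMeasure = ∫ x, g x * φ x ∂unitMeasure := by
      refine integral_congr_ae ?_
      filter_upwards [ha.absolutelyContinuous_weightMeasure.ae_le hg,
        ae_unitMeasure fun x hx => (ha.pos_of_mem_Ioo hx).ne'] with x h1 h3
      rw [h1, mul_div_cancel_left₀ _ h3]
    rw [h6]
    linarith
  · intro hp
    set w := ContinuousLinearMap.adjoint ha.embedding p.snd with hw
    refine ⟨⟨ha.curvatureEquiv.symm w, by rw [ha.incl_curvatureEquiv_symm, hp]⟩,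
      primitive (primitive (w : L2)), fun x => p.snd x / a x,
      ⟨(isH20_of_curvature w).continuousOn.locallyIntegrableOn_Ioo,
        ha.locallyIntegrableOn_div (Lp.memLp p.snd), fun φ hφ => ?_⟩, ?_, ?_⟩
    · have h2 := (isH20_of_curvature w).weakDeriv_two.2.2 _ hφ.deriv.deriv
      rw [show iteratedDeriv 4 φ = iteratedDeriv 2 (deriv (deriv φ)) by
        rw [iteratedDeriv_succ', iteratedDeriv_succ'], h2]
      have h3 := ContinuousLinearMap.adjoint_inner_right ha.embedding hφ.curvature p.snd
      rw [← hw, hφ.inner_curvature, hφ.inner_embedding ha] at h3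
      rw [h3]
      ring
    · rw [hp]
      exact ha.embedding_ae w
    · filter_upwards [weightMeasure_absolutelyContinuous.ae_le
        (ae_unitMeasure fun x hx => (ha.pos_of_mem_Ioo hx).ne')] with x hx
      rw [mul_div_cancel₀ _ hx]

end Curvature

/-! ### The beam equation -/

section Beam

variable {a : ℝ → ℝ}

/-- The energy space `H²_{1/a} × L²_{1/a}` in terms of `(u'', v)`, with the squared norm
`‖u''‖² + ‖v‖²` that the flow conserves. -/
abbrev EnergySpace (a : ℝ → ℝ) : Type := WithLp 2 (Curvature × L2w a)

/-- The inverse of `𝒜 (u, v) = (v, -A u)` on the energy space: `(f, g) ↦ (-A⁻¹ g, f)`, where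
`A⁻¹ = ι ι†` by `DegenerateCoefficient.mem_domA_iff`. -/
noncomputable def DegenerateCoefficient.beamInverse (ha : DegenerateCoefficient a) :
    EnergySpace a →L[ℝ] EnergySpace a :=
  (WithLp.prodContinuousLinearEquiv 2 ℝ Curvature (L2w a)).symm.toContinuousLinearMap ∘L
    ((-(ContinuousLinearMap.adjoint ha.embedding ∘L WithLp.sndL 2 ℝ Curvature (L2w a))).prod
      (ha.embedding ∘L WithLp.fstL 2 ℝ Curvature (L2w a)))

theorem DegenerateCoefficient.beamInverse_apply (ha : DegenerateCoefficient a)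
    (x : EnergySpace a) : ha.beamInverse x =
      WithLp.toLp 2 (-ContinuousLinearMap.adjoint ha.embedding x.snd, ha.embedding x.fst) := rfl

theorem DegenerateCoefficient.isSkew_beamInverse (ha : DegenerateCoefficient a) :
    IsSkew ha.beamInverse := by
  intro x y
  rw [ha.beamInverse_apply, ha.beamInverse_apply, WithLp.prod_inner_apply, WithLp.prod_inner_apply]
  change inner ℝ (-ContinuousLinearMap.adjoint ha.embedding x.snd) y.fst +
      inner ℝ (ha.embedding x.fst) y.snd =
    -(inner ℝ x.fst (-ContinuousLinearMap.adjoint ha.embedding y.snd) +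
      inner ℝ x.snd (ha.embedding y.fst))
  rw [inner_neg_left, inner_neg_right, ContinuousLinearMap.adjoint_inner_left,
    ContinuousLinearMap.adjoint_inner_right]
  ring

theorem DegenerateCoefficient.beamInverse_eq_zero (ha : DegenerateCoefficient a)
    (x : EnergySpace a) (hx : ha.beamInverse x = 0) : x = 0 := by
  have h1 : -ContinuousLinearMap.adjoint ha.embedding x.snd = 0 := congrArg WithLp.fst hx
  have h2 : ha.embedding x.fst = 0 := congrArg WithLp.snd hx
  apply WithLp.ofLp_injective
  exact Prod.ext (ha.embedding_eq_zero h2) (ha.adjoint_embedding_eq_zero (neg_eq_zero.1 h1))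

/-- `IsBeamOp` in terms of `ι` and its adjoint. -/
theorem DegenerateCoefficient.isBeamOp_iff (ha : DegenerateCoefficient a) {P Q F G : L2w a} :
    IsBeamOp a (P, Q) (F, G) ↔ (∃ v, Q = ha.embedding v) ∧ F = Q ∧
      P = -ha.embedding (ContinuousLinearMap.adjoint ha.embedding G) := by
  constructor
  · rintro ⟨u, v, hU, hF⟩
    obtain ⟨rfl, rfl⟩ := Prod.mk.inj hU
    obtain ⟨rfl, rfl⟩ := Prod.mk.inj hF
    refine ⟨⟨_, (ha.embedding_curvatureEquiv v).symm⟩, rfl, ?_⟩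
    rw [map_neg, map_neg, neg_neg]
    exact ha.mem_domA_iff.1 u.2
  · rintro ⟨⟨v, rfl⟩, rfl, rfl⟩
    refine ⟨⟨WithLp.toLp 2 (-ha.embedding (ContinuousLinearMap.adjoint ha.embedding G), -G),
      ha.mem_domA_iff.2 ?_⟩, ha.curvatureEquiv.symm v, ?_, ?_⟩
    · simp
    · rw [ha.incl_curvatureEquiv_symm]
      rfl
    · rw [ha.incl_curvatureEquiv_symm]
      simp [DomA.opA]

/-- The state `(y'', y_t)` in the energy space. -/
noncomputable def DegenerateCoefficient.state (ha : DegenerateCoefficient a) (y : ℝ → H2w a)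
    (t : ℝ) : EnergySpace a :=
  WithLp.toLp 2 (ha.curvatureEquiv (y t), timeDeriv y t)

theorem IsMildSolution.continuousOn_timeDeriv {y₀ : H2w a} {y₁ : L2w a} {y : ℝ → H2w a}
    (h : IsMildSolution a y₀ y₁ y) : ContinuousOn (timeDeriv y) (Ici 0) :=
  h.contDiffOn.continuousOn_derivWithin (uniqueDiffOn_Ici 0) le_rfl

theorem continuous_incl : Continuous (H2w.incl : H2w a → L2w a) :=
  (WithLp.fstL 2 ℝ (L2w a) (WithLp 2 (L2 × L2))).continuous.comp continuous_subtype_val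

theorem IsMildSolution.continuousOn_state (ha : DegenerateCoefficient a) {y₀ : H2w a} {y₁ : L2w a}
    {y : ℝ → H2w a} (h : IsMildSolution a y₀ y₁ y) : ContinuousOn (ha.state y) (Ici 0) :=
  (WithLp.prodContinuousLinearEquiv 2 ℝ Curvature (L2w a)).symm.continuous.comp_continuousOn
    ((ha.curvatureEquiv.continuous.comp_continuousOn h.continuousOn).prodMk
      h.continuousOn_timeDeriv)

theorem IsMildSolution.state_zero (ha : DegenerateCoefficient a) {y₀ : H2w a} {y₁ : L2w a}
    {y : ℝ → H2w a} (h : IsMildSolution a y₀ y₁ y) :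
    ha.state y 0 = WithLp.toLp 2 (ha.curvatureEquiv y₀, y₁) := by
  rw [DegenerateCoefficient.state, h.init, h.init_deriv]

/-- A mild solution is a trajectory of the inverse generator. -/
theorem IsMildSolution.beamInverse_state (ha : DegenerateCoefficient a) {y₀ : H2w a} {y₁ : L2w a}
    {y : ℝ → H2w a} (h : IsMildSolution a y₀ y₁ y) (t : ℝ) (ht : 0 ≤ t) :
    ha.beamInverse (ha.state y t - ha.state y 0) = ∫ s in (0 : ℝ)..t, ha.state y s := by
  have hint : ∀ {E : Type} [NormedAddCommGroup E] {f : ℝ → E}, ContinuousOn f (Ici 0) →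
      IntervalIntegrable f volume 0 t := fun hf =>
    (hf.mono (by rw [uIcc_of_le ht]; exact Icc_subset_Ici_self)).intervalIntegrable
  have hU : IntervalIntegrable (beamState y) volume 0 t :=
    hint ((continuous_incl.comp_continuousOn h.continuousOn).prodMk h.continuousOn_timeDeriv)
  have hS := hint (h.continuousOn_state ha)
  have hm := h.mild t ht
  have e1 := (ContinuousLinearMap.fst ℝ (L2w a) (L2w a)).intervalIntegral_comp_comm hU
  have e2 := (ContinuousLinearMap.snd ℝ (L2w a) (L2w a)).intervalIntegral_comp_comm hU
  rw [← Prod.mk.eta (p := ∫ s in (0 : ℝ)..t, beamState y s),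
    ← Prod.mk.eta (p := beamState y t - beamState y 0), ha.isBeamOp_iff] at hm
  obtain ⟨-, hm1, hm2⟩ := hm
  have s1 := (WithLp.fstL 2 ℝ Curvature (L2w a)).intervalIntegral_comp_comm hS
  have s2 := (WithLp.sndL 2 ℝ Curvature (L2w a)).intervalIntegral_comp_comm hS
  have s3 := ha.embedding.intervalIntegral_comp_comm
    (hint (ha.curvatureEquiv.continuous.comp_continuousOn h.continuousOn))
  apply WithLp.ofLp_injective
  refine Prod.ext ?_ ?_
  · refine Eq.trans ?_ s1
    refine sub_eq_zero.1 (ha.embedding_eq_zero ?_)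
    change ha.embedding (-ContinuousLinearMap.adjoint ha.embedding (timeDeriv y t - timeDeriv y 0) -
      ∫ s in (0 : ℝ)..t, ha.curvatureEquiv (y s)) = 0
    rw [map_sub, map_neg, sub_eq_zero]
    refine Eq.trans hm2.symm (e1.symm.trans (Eq.trans ?_ s3))
    exact intervalIntegral.integral_congr fun s _ => (ha.embedding_curvatureEquiv (y s)).symm
  · refine Eq.trans ?_ s2
    refine Eq.trans ?_ (hm1.trans e2.symm)
    change ha.embedding (ha.curvatureEquiv (y t) - ha.curvatureEquiv (y 0)) =
      H2w.incl (y t) - H2w.incl (y 0)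
    rw [map_sub, ha.embedding_curvatureEquiv, ha.embedding_curvatureEquiv]

/-- The second component of the trajectory equation, `ι f(t) - ι f(0) = ∫₀ᵗ g`, differentiated. -/
theorem DegenerateCoefficient.hasDerivAt_embedding (ha : DegenerateCoefficient a)
    {u : ℝ → EnergySpace a} (hu : Continuous u)
    (h : ∀ t, ha.beamInverse (u t - u 0) = ∫ s in (0 : ℝ)..t, u s) (t : ℝ) :
    HasDerivAt (fun s => ha.embedding (u s).fst) (u t).snd t := by
  have hc : Continuous fun s => (u s).snd :=
    (WithLp.sndL 2 ℝ Curvature (L2w a)).continuous.comp hu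
  have heq : (fun s => ha.embedding (u s).fst) =
      fun t => ha.embedding (u 0).fst + ∫ s in (0 : ℝ)..t, (u s).snd := by
    ext1 t
    have h1 : ha.embedding (u t - u 0).fst = ∫ s in (0 : ℝ)..t, (u s).snd :=
      (congrArg WithLp.snd (h t)).trans ((WithLp.sndL 2 ℝ Curvature
        (L2w a)).intervalIntegral_comp_comm (hu.intervalIntegrable 0 t)).symm
    rw [← h1, WithLp.sub_fst, map_sub]
    abel
  rw [heq]
  exact (hc.integral_hasStrictDerivAt 0 t).hasDerivAt.const_add _

/-- A trajectory of the inverse generator gives a mild solution. -/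
theorem DegenerateCoefficient.isMildSolution_of_trajectory (ha : DegenerateCoefficient a)
    {u : ℝ → EnergySpace a} (hu : Continuous u)
    (h : ∀ t, ha.beamInverse (u t - u 0) = ∫ s in (0 : ℝ)..t, u s) :
    IsMildSolution a (ha.curvatureEquiv.symm (u 0).fst) (u 0).snd
      (fun t => ha.curvatureEquiv.symm (u t).fst) := by
  have hc1 : Continuous fun s => (u s).fst :=
    (WithLp.fstL 2 ℝ Curvature (L2w a)).continuous.comp hu
  have hc2 : Continuous fun s => (u s).snd :=
    (WithLp.sndL 2 ℝ Curvature (L2w a)).continuous.comp hu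
  have hd := ha.hasDerivAt_embedding hu h
  have hincl : (fun t => H2w.incl (ha.curvatureEquiv.symm (u t).fst)) =
      fun t => ha.embedding (u t).fst := funext fun t => ha.incl_curvatureEquiv_symm _
  have htd : ∀ t, 0 ≤ t → timeDeriv (fun t => ha.curvatureEquiv.symm (u t).fst) t = (u t).snd := by
    intro t ht
    rw [timeDeriv, hincl]
    exact (hd t).hasDerivWithinAt.derivWithin (uniqueDiffOn_Ici 0 t ht)
  have hbs : ∀ t, 0 ≤ t → beamState (fun t => ha.curvatureEquiv.symm (u t).fst) t =
      (ha.embedding (u t).fst, (u t).snd) := by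
    intro t ht
    rw [beamState, htd t ht, ha.incl_curvatureEquiv_symm]
  refine ⟨?_, (ha.curvatureEquiv.symm.continuous.comp hc1).continuousOn, rfl, htd 0 le_rfl,
    fun t ht => ?_⟩
  · rw [hincl]
    refine (contDiff_one_iff_deriv.2 ⟨fun t => (hd t).differentiableAt, ?_⟩).contDiffOn
    rwa [funext fun t => (hd t).deriv]
  · have hint : ∫ s in (0 : ℝ)..t, beamState (fun t => ha.curvatureEquiv.symm (u t).fst) s =
        ∫ s in (0 : ℝ)..t, (ha.embedding (u s).fst, (u s).snd) := by
      refine intervalIntegral.integral_congr fun s hs => hbs s ?_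
      rw [uIcc_of_le ht] at hs
      exact hs.1
    have hi : IntervalIntegrable (fun s => (ha.embedding (u s).fst, (u s).snd)) volume 0 t :=
      ((ha.embedding.continuous.comp hc1).prodMk hc2).intervalIntegrable 0 t
    have e1 := (ContinuousLinearMap.fst ℝ (L2w a) (L2w a)).intervalIntegral_comp_comm hi
    have e2 := (ContinuousLinearMap.snd ℝ (L2w a) (L2w a)).intervalIntegral_comp_comm hi
    have s1 := (WithLp.fstL 2 ℝ Curvature (L2w a)).intervalIntegral_comp_comm
      (hu.intervalIntegrable (μ := volume) 0 t)
    have s2 := (WithLp.sndL 2 ℝ Curvature (L2w a)).intervalIntegral_comp_comm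
      (hu.intervalIntegrable (μ := volume) 0 t)
    have r1 : -ContinuousLinearMap.adjoint ha.embedding (u t - u 0).snd =
      ∫ s in (0 : ℝ)..t, (u s).fst := (congrArg WithLp.fst (h t)).trans s1.symm
    have r2 : ha.embedding (u t - u 0).fst =
      ∫ s in (0 : ℝ)..t, (u s).snd := (congrArg WithLp.snd (h t)).trans s2.symm
    have s3 := ha.embedding.intervalIntegral_comp_comm (hc1.intervalIntegrable (μ := volume) 0 t)
    rw [hint, hbs t ht, hbs 0 le_rfl,
      ← Prod.mk.eta (p := ∫ s in (0 : ℝ)..t, (ha.embedding (u s).fst, (u s).snd))]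
    refine ha.isBeamOp_iff.2 ⟨⟨(u t - u 0).fst, e2.symm.trans r2.symm⟩, ?_, ?_⟩
    · rw [← map_sub]
      exact r2.trans e2
    · refine e1.symm.trans (s3.trans ?_)
      rw [← r1, map_neg]
      rfl

theorem IsMildSolution.state_eq_trajectory (ha : DegenerateCoefficient a) {y₀ : H2w a} {y₁ : L2w a}
    {y : ℝ → H2w a} (h : IsMildSolution a y₀ y₁ y) {u : ℝ → EnergySpace a} (hu : Continuous u)
    (hu0 : u 0 = WithLp.toLp 2 (ha.curvatureEquiv y₀, y₁))
    (hRu : ∀ t, ha.beamInverse (u t - u 0) = ∫ s in (0 : ℝ)..t, u s) {t : ℝ} (ht : 0 ≤ t) :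
    ha.state y t = u t :=
  ha.isSkew_beamInverse.trajectory_unique ha.beamInverse_eq_zero (h.continuousOn_state ha)
    hu.continuousOn ((h.state_zero ha).trans hu0.symm) (h.beamInverse_state ha)
    (fun t _ => hRu t) ht

theorem DegenerateCoefficient.exists_isMildSolution (ha : DegenerateCoefficient a) (y₀ : H2w a)
    (y₁ : L2w a) : ∃ y : ℝ → H2w a, IsMildSolution a y₀ y₁ y ∧
      ∀ z : ℝ → H2w a, IsMildSolution a y₀ y₁ z → EqOn z y (Ici 0) := by
  obtain ⟨u, hu, hu0, -, hRu⟩ := ha.isSkew_beamInverse.exists_trajectory ha.beamInverse_eq_zero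
    (WithLp.toLp 2 (ha.curvatureEquiv y₀, y₁))
  rw [← hu0] at hRu
  refine ⟨fun t => ha.curvatureEquiv.symm (u t).fst, ?_, fun z hz t ht => ?_⟩
  · have h := ha.isMildSolution_of_trajectory hu hRu
    simpa [hu0] using h
  · have h := hz.state_eq_trajectory ha hu hu0 hRu ht
    simp only [← h, state]
    exact (ha.curvatureEquiv.symm_apply_apply (z t)).symm

theorem norm_toLp_prod_le {E F : Type*} [NormedAddCommGroup E] [NormedAddCommGroup F] (x : E)
    (y : F) : ‖WithLp.toLp 2 (x, y)‖ ≤ ‖x‖ + ‖y‖ := by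
  rw [WithLp.prod_norm_eq_of_L2]
  refine Real.sqrt_le_iff.2 ⟨by positivity, ?_⟩
  change ‖x‖ ^ 2 + ‖y‖ ^ 2 ≤ _
  nlinarith [norm_nonneg x, norm_nonneg y, mul_nonneg (norm_nonneg x) (norm_nonneg y)]

theorem IsMildSolution.norm_state_sub (ha : DegenerateCoefficient a) {y₀ z₀ : H2w a}
    {y₁ z₁ : L2w a} {y z : ℝ → H2w a} (hy : IsMildSolution a y₀ y₁ y)
    (hz : IsMildSolution a z₀ z₁ z) {t : ℝ} (ht : 0 ≤ t) :
    ‖ha.state y t - ha.state z t‖ = ‖ha.state y 0 - ha.state z 0‖ := by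
  refine ha.isSkew_beamInverse.norm_trajectory ha.beamInverse_eq_zero
    (u := fun t => ha.state y t - ha.state z t)
    ((hy.continuousOn_state ha).sub (hz.continuousOn_state ha)) (fun t ht => ?_) ht
  have hsub : uIcc 0 t ⊆ Ici (0 : ℝ) := by
    rw [uIcc_of_le ht]
    exact Icc_subset_Ici_self
  rw [intervalIntegral.integral_sub ((hy.continuousOn_state ha).mono hsub).intervalIntegrable
    ((hz.continuousOn_state ha).mono hsub).intervalIntegrable, ← hy.beamInverse_state ha t ht,
    ← hz.beamInverse_state ha t ht, ← map_sub]
  congr 1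
  abel

theorem DegenerateCoefficient.exists_stability_constant (ha : DegenerateCoefficient a) :
    ∃ C : ℝ, ∀ (y₀ z₀ : H2w a) (y₁ z₁ : L2w a) (y z : ℝ → H2w a),
      IsMildSolution a y₀ y₁ y → IsMildSolution a z₀ z₁ z → ∀ t : ℝ, 0 ≤ t →
        ‖y t - z t‖ + ‖timeDeriv y t - timeDeriv z t‖ ≤ C * (‖y₀ - z₀‖ + ‖y₁ - z₁‖) := by
  set e := ha.curvatureEquiv with he
  refine ⟨(‖(e.symm : Curvature →L[ℝ] H2w a)‖ + 1) * (‖(e : H2w a →L[ℝ] Curvature)‖ + 1),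
    fun y₀ z₀ y₁ z₁ y z hy hz t ht => ?_⟩
  set D := ha.state y t - ha.state z t with hD
  have h1 : ‖y t - z t‖ ≤ ‖(e.symm : Curvature →L[ℝ] H2w a)‖ * ‖D‖ := by
    have h2 : y t - z t = (e.symm : Curvature →L[ℝ] H2w a) D.fst := by
      rw [hD, WithLp.sub_fst, map_sub]
      simp [state, he]
    rw [h2]
    refine (ContinuousLinearMap.le_opNorm _ _).trans ?_
    gcongr
    exact WithLp.norm_fst_le _ D
  have h3 : ‖timeDeriv y t - timeDeriv z t‖ ≤ ‖D‖ := WithLp.norm_snd_le _ D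
  have h4 : ‖D‖ ≤ ‖(e : H2w a →L[ℝ] Curvature)‖ * ‖y₀ - z₀‖ + ‖y₁ - z₁‖ := by
    rw [hD, hy.norm_state_sub ha hz ht, hy.state_zero, hz.state_zero, ← WithLp.toLp_sub,
      Prod.mk_sub_mk, ← map_sub]
    refine (norm_toLp_prod_le _ _).trans ?_
    gcongr
    exact (e : H2w a →L[ℝ] Curvature).le_opNorm _
  have h5 : ‖D‖ ≤ (‖(e : H2w a →L[ℝ] Curvature)‖ + 1) * (‖y₀ - z₀‖ + ‖y₁ - z₁‖) := by
    nlinarith [norm_nonneg (y₀ - z₀), norm_nonneg (y₁ - z₁),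
      norm_nonneg (e : H2w a →L[ℝ] Curvature)]
  calc ‖y t - z t‖ + ‖timeDeriv y t - timeDeriv z t‖
      ≤ (‖(e.symm : Curvature →L[ℝ] H2w a)‖ + 1) * ‖D‖ := by linarith
    _ ≤ _ := by
      rw [mul_assoc]
      gcongr

/-- Data in the domain of `𝒜` have the form `R z`, and then the solution is `R Z` with `Z` the
trajectory that starts at `z`; so `Z` is the time derivative of the state. -/
theorem IsMildSolution.isClassical (ha : DegenerateCoefficient a) {y₀ : H2w a} {y₁ : L2w a}
    {y : ℝ → H2w a} (hu : ∃ u : DomA a, DomA.incl u = H2w.incl y₀)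
    (hv : ∃ v : H2w a, H2w.incl v = y₁) (h : IsMildSolution a y₀ y₁ y) : IsClassical a y := by
  obtain ⟨u, hu⟩ := hu
  obtain ⟨v, rfl⟩ := hv
  obtain ⟨Z, hZ, hZ0, -, hRZ⟩ := ha.isSkew_beamInverse.exists_trajectory ha.beamInverse_eq_zero
    (WithLp.toLp 2 (ha.curvatureEquiv v, -DomA.opA u))
  rw [← hZ0] at hRZ
  set W : ℝ → EnergySpace a := fun t => ha.beamInverse (Z t) with hW
  have hWc : Continuous W := ha.beamInverse.continuous.comp hZ
  have hRW : ∀ t, ha.beamInverse (W t - W 0) = ∫ s in (0 : ℝ)..t, W s := fun t => by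
    simp only [hW]
    rw [ha.beamInverse.intervalIntegral_comp_comm (hZ.intervalIntegrable 0 t), ← hRZ t, ← map_sub]
  have hW0 : W 0 = WithLp.toLp 2 (ha.curvatureEquiv y₀, H2w.incl v) := by
    have h1 : ContinuousLinearMap.adjoint ha.embedding (DomA.opA u) = ha.curvatureEquiv y₀ := by
      refine sub_eq_zero.1 (ha.embedding_eq_zero ?_)
      rw [map_sub, ha.embedding_curvatureEquiv, ← hu, sub_eq_zero]
      exact (ha.mem_domA_iff.1 u.2).symm
    simp only [hW]
    rw [ha.beamInverse_apply, hZ0]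
    simp [h1, ha.embedding_curvatureEquiv]
  have hstate : ∀ t, 0 ≤ t → ha.state y t = W t := fun t ht =>
    h.state_eq_trajectory ha hWc hW0 hRW ht
  have hy : ∀ t, 0 ≤ t → y t = ha.curvatureEquiv.symm (W t).fst := fun t ht => by
    rw [← hstate t ht]
    exact (ha.curvatureEquiv.symm_apply_apply (y t)).symm
  have hincl : ∀ t, 0 ≤ t → H2w.incl (y t) = ha.embedding (W t).fst := fun t ht => by
    rw [hy t ht, ha.incl_curvatureEquiv_symm]
  have hWd : ∀ t, HasDerivAt W (Z t) t := by
    intro t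
    have heq : W = fun t => W 0 + ∫ s in (0 : ℝ)..t, Z s := by
      ext1 t
      rw [← hRZ t, map_sub]
      simp only [hW]
      abel
    rw [heq]
    exact (hZ.integral_hasStrictDerivAt 0 t).hasDerivAt.const_add _
  have hWs : ContDiff ℝ 1 W := by
    refine contDiff_one_iff_deriv.2 ⟨fun t => (hWd t).differentiableAt, ?_⟩
    rwa [funext fun t => (hWd t).deriv]
  have hF := ha.hasDerivAt_embedding hWc hRW
  have hF' : deriv (fun s => ha.embedding (W s).fst) = fun t => (W t).snd :=
    funext fun t => (hF t).deriv
  have hG : ∀ t, HasDerivAt (fun s => (W s).snd) (Z t).snd t := fun t =>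
    (WithLp.sndL 2 ℝ Curvature (L2w a)).hasFDerivAt.comp_hasDerivAt t (hWd t)
  have hF2 : ContDiff ℝ 2 fun s => ha.embedding (W s).fst := by
    rw [show (2 : WithTop ℕ∞) = 1 + 1 by norm_num, contDiff_succ_iff_deriv]
    refine ⟨fun t => (hF t).differentiableAt, by simp, ?_⟩
    rw [hF']
    exact (WithLp.sndL 2 ℝ Curvature (L2w a)).contDiff.comp hWs
  have hmem : ∀ t, WithLp.toLp 2 (ha.embedding (W t).fst, -(Z t).snd) ∈ DomA a := fun t => by
    refine ha.mem_domA_iff.2 ?_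
    change ha.embedding (-ContinuousLinearMap.adjoint ha.embedding (Z t).snd) =
      ha.embedding (ContinuousLinearMap.adjoint ha.embedding (-(Z t).snd))
    rw [map_neg (ContinuousLinearMap.adjoint ha.embedding)]
  refine ⟨hF2.contDiffOn.congr hincl, ?_, fun t => ⟨_, hmem t⟩, ?_, fun t ht => ⟨?_, ?_⟩⟩
  · refine ContDiffOn.congr (ContDiff.contDiffOn ?_) hy
    exact ha.curvatureEquiv.symm.contDiff.comp
      ((WithLp.fstL 2 ℝ Curvature (L2w a)).contDiff.comp hWs)
  · refine Continuous.continuousOn (Continuous.subtype_mk ?_ hmem)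
    exact (WithLp.prodContinuousLinearEquiv 2 ℝ (L2w a) (L2w a)).symm.continuous.comp
      (hF2.continuous.prodMk ((WithLp.sndL 2 ℝ Curvature (L2w a)).continuous.comp hZ).neg)
  · exact (hincl t ht).symm
  · have hE : EqOn (fun s => H2w.incl (y s)) (fun s => ha.embedding (W s).fst) (Ici 0) := hincl
    rw [iteratedDerivWithin_congr hE ht, iteratedDerivWithin_eq_iteratedDeriv
      (uniqueDiffOn_Ici 0) hF2.contDiffAt ht, iteratedDeriv_succ, iteratedDeriv_one, hF',
      (hG t).deriv]
    exact add_neg_cancel _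

end Beam

theorem theorem2p6 (a : ℝ → ℝ) (ha : DegenerateCoefficient a) :
    -- existence and uniqueness of the mild solution, for all data in `H²_{1/a} × L²_{1/a}`
    (∀ (y₀ : H2w a) (y₁ : L2w a), ∃ y : ℝ → H2w a, IsMildSolution a y₀ y₁ y ∧
      ∀ z : ℝ → H2w a, IsMildSolution a y₀ y₁ z → EqOn z y (Ici 0)) ∧
    -- continuous dependence on the data
    (∃ C : ℝ, ∀ (y₀ z₀ : H2w a) (y₁ z₁ : L2w a) (y z : ℝ → H2w a),
      IsMildSolution a y₀ y₁ y → IsMildSolution a z₀ z₁ z → ∀ t : ℝ, 0 ≤ t →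
        ‖y t - z t‖ + ‖timeDeriv y t - timeDeriv z t‖ ≤ C * (‖y₀ - z₀‖ + ‖y₁ - z₁‖)) ∧
    -- data in `D(𝒜) = D(A) × H²_{1/a}`: the solution is classical
    (∀ (y₀ : H2w a) (y₁ : L2w a) (y : ℝ → H2w a),
      (∃ u : DomA a, DomA.incl u = H2w.incl y₀) → (∃ v : H2w a, H2w.incl v = y₁) →
        IsMildSolution a y₀ y₁ y → IsClassical a y) := by
  exact ⟨ha.exists_isMildSolution, ha.exists_stability_constant,
    fun _ _ _ hu hv h => h.isClassical ha hu hv⟩
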